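/- Let $T\subset\mathbb R^2$ be a nondegenerate closed triangle with vertices $v_1,v_2,v_3$. Write $P_m(T)$ for the real polynomials of degree at most $m$ on $T$, $\mathbb S^2$ for the symmetric $2\times 2$ matrices, $n$ for a unit normal on each edge, and $\mathbf{RM}=\mathrm{span}\{(1,0)^T,(0,1)^T,(-y,x)^T\}$. For an integer $k\ge 1$ define \begin{align*} \mathring U_{k+2}(T)&=\{u\in P_{k+2}(T):\ \nabla^\alpha u(v_i)=0\ \text{for } |\alpha|\le 4,\ i=1,2,3;\ u|_{\partial T}=\tfrac{\partial u}{\partial n}|_{\partial T}=\tfrac{\partial^2u}{\partial n^2}|_{\partial T}=0\},\\ \mathring\Sigma_k(T)&=\{\sigma\in P_k(T;\mathbb S^2):\ \nabla^\alpha\sigma(v_i)=0\ \text{for } |\alpha|\le 2,\ i=1,2,3;\ \sigma|_{\partial T}=0\},\\ \mathring Q_{k-1}(T)&=\{q\in P_{k-1}(T;\mathbb R^2):\ \nabla^\alpha q(v_i)=0\ \text{for } |\alpha|\le 1,\ i=1,2,3\}, \end{align*} and let $\mathring Q_{k-1}(T)\cap\mathbf{RM}^\perp$ be the set of $q\in\mathring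 Q_{k-1}(T)$ with $\int_T q\cdot r\,dx=0$ for all $r\in\mathbf{RM}$. Let $\operatorname{curl}\operatorname{curl}^T u=\begin{pmatrix}u_{yy}&-u_{xy}\\-u_{xy}&u_{xx}\end{pmatrix}$ and let $\operatorname{div}$ be the row-wise divergence. (1) For every integer $k\ge 1$ and every triangle $T$, the sequence $$0\to\mathring U_{k+2}(T)\xrightarrow{\ \operatorname{curl}\operatorname{curl}^T\ }\mathring\Sigma_k(T)\xrightarrow{\ \operatorname{div}\ }\mathring Q_{k-1}(T)\cap\mathbf{RM}^\perp\to 0$$ is a well-defined complex and is exact. (2) Let $k\ge 7$ and $\kappa\in\mathbb R$. There is a constant $C$, depending only on $k$ and $\kappa$, such that for every triangle $T$ whose shape regularity constant (the diameter of $T$ divided by the diameter of its largest inscribed disc) is at most $\kappa$ there is a linear map $R:\mathring Q_{k-1}(T)\cap\mathbf{RM}^\perp\to\mathring\Sigma_k(T)$ such that, for all $q$, $$\operatorname{div}(Rq)=q,\qquad \|\nabla (Rq)\|_{L^2(T)}\le C\,\|q\|_{L^2(T)},\qquad \|Rq\|_{H^1(T)}\le C\,\max\{1,\operatorname{diam}T\}\,\|q\|_{L^2(T)}.$$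 Here $\|\sigma\|_{H^1(T)}^2=\|\sigma\|_{L^2(T)}^2+\|\nabla\sigma\|_{L^2(T)}^2$. -/

import Mathlib

open MeasureTheory

noncomputable section

namespace BubbleComplex

/-- The Euclidean plane. -/
abbrev Plane : Type := EuclideanSpace ℝ (Fin 2)

/-- Real polynomials in the two coordinates `x = X 0`, `y = X 1`. A triangle has nonempty interior,
so polynomials and polynomial functions on a triangle are identified. -/
abbrev Poly : Type := MvPolynomial (Fin 2) ℝ

/-- The value of a polynomial at a point of the plane. -/
def val (p : Poly) (x : Plane) : ℝ := MvPolynomial.eval (fun i => x i) p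

/-- The partial derivative `∂ / ∂ x_i`. -/
def partialD (i : Fin 2) : Module.End ℝ Poly := (MvPolynomial.pderiv i).toLinearMap

/-- The derivative `∇ ^ α` for the multi-index `α = (a, b)`. -/
def multiD (a b : ℕ) : Module.End ℝ Poly := partialD 0 ^ a * partialD 1 ^ b

/-- The two components of the scalar curl: `curl u = (∇ u)^⊥ = (∂u/∂y, -∂u/∂x)`. -/
def curlComp (i : Fin 2) : Module.End ℝ Poly := ![partialD 1, -partialD 0] i

/-- The Airy operator `curl curl^T`, that is `u ↦ [[u_yy, -u_xy], [-u_xy, u_xx]]`. -/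
def airy : Poly →ₗ[ℝ] Matrix (Fin 2) (Fin 2) Poly where
  toFun u := Matrix.of fun i j => curlComp i (curlComp j u)
  map_add' u v := by ext1 i j; simp
  map_smul' c u := by ext1 i j; simp

/-- The row-wise divergence of a matrix field. -/
def div : Matrix (Fin 2) (Fin 2) Poly →ₗ[ℝ] (Fin 2 → Poly) where
  toFun σ := fun i => ∑ j, partialD j (σ i j)
  map_add' σ τ := by ext1 i; simp [Finset.sum_add_distrib]
  map_smul' c σ := by ext1 i; simp

/-- A (nondegenerate) triangle in the plane, given by its three vertices. -/
abbrev Triangle : Type := Affine.Triangle ℝ Plane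

/-- The closed triangle as a set of points. -/
def region (T : Triangle) : Set Plane := convexHull ℝ (Set.range T.points)

/-- The closed edge opposite to the `i`-th vertex (indices modulo 3). The boundary of the triangle
is the union of the three edges. -/
def edge (T : Triangle) (i : Fin 3) : Set Plane := segment ℝ (T.points (i + 1)) (T.points (i + 2))

/-- The edge vector of the `i`-th edge. -/
def edgeVec (T : Triangle) (i : Fin 3) : Plane := T.points (i + 2) - T.points (i + 1)

/-- The unit normal `t^⊥` of the `i`-th edge, with `t` the unit tangent and `(a, b)^⊥ = (b, -a)`. -/
def edgeNormal (T : Triangle) (i : Fin 3) : Plane :=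
  ‖edgeVec T i‖⁻¹ • !₂[edgeVec T i 1, -edgeVec T i 0]

/-- The derivative `∂ / ∂n` in the direction of the unit normal of the `i`-th edge. -/
def normalD (T : Triangle) (i : Fin 3) : Module.End ℝ Poly :=
  edgeNormal T i 0 • partialD 0 + edgeNormal T i 1 • partialD 1

/-- All derivatives of `p` of order at most `m` vanish at every vertex of the triangle. -/
def VanishesAtVertices (T : Triangle) (m : ℕ) (p : Poly) : Prop :=
  ∀ (v : Fin 3) (a b : ℕ), a + b ≤ m → val (multiD a b p) (T.points v) = 0

/-- Polynomials of total degree at most `d`. -/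
abbrev polyDeg (d : ℕ) : Submodule ℝ Poly := MvPolynomial.restrictTotalDegree (Fin 2) ℝ d

theorem val_zero (x : Plane) : val 0 x = 0 := by simp [val]

theorem val_add (p q : Poly) (x : Plane) : val (p + q) x = val p x + val q x := by simp [val]

theorem val_smul (c : ℝ) (p : Poly) (x : Plane) : val (c • p) x = c * val p x := by
  simp [val, MvPolynomial.smul_eval]

theorem continuous_val (p : Poly) : Continuous (val p) := by
  unfold val
  exact (MvPolynomial.continuous_eval p).comp (by fun_prop)

theorem isCompact_region (T : Triangle) : IsCompact (region T) :=
  (Set.finite_range T.points).isCompact_convexHull (𝕜 := ℝ)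

theorem VanishesAtVertices.zero (T : Triangle) (m : ℕ) : VanishesAtVertices T m 0 := by
  intro v a b _
  simp [val_zero]

theorem VanishesAtVertices.add {T : Triangle} {m : ℕ} {p q : Poly}
    (hp : VanishesAtVertices T m p) (hq : VanishesAtVertices T m q) :
    VanishesAtVertices T m (p + q) := by
  intro v a b h
  rw [map_add, val_add, hp v a b h, hq v a b h, add_zero]

theorem VanishesAtVertices.smul {T : Triangle} {m : ℕ} {p : Poly} (c : ℝ)
    (hp : VanishesAtVertices T m p) : VanishesAtVertices T m (c • p) := by
  intro v a b h
  rw [map_smul, val_smul, hp v a b h, mul_zero]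

/-- The scalar bubbles of degree `d` (used with `d = k + 2`): all derivatives of order at most 4
vanish at the vertices, and `u`, `∂u/∂n`, `∂²u/∂n²` vanish on the boundary. -/
def bubbleU (T : Triangle) (d : ℕ) : Submodule ℝ Poly where
  carrier := {u | u ∈ polyDeg d ∧ VanishesAtVertices T 4 u ∧
    ∀ i, ∀ x ∈ edge T i,
      val u x = 0 ∧ val (normalD T i u) x = 0 ∧ val (normalD T i (normalD T i u)) x = 0}
  zero_mem' := ⟨zero_mem _, VanishesAtVertices.zero T 4, fun i x _ => by simp [val_zero]⟩
  add_mem' := by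
    rintro p q ⟨hp1, hp2, hp3⟩ ⟨hq1, hq2, hq3⟩
    refine ⟨add_mem hp1 hq1, hp2.add hq2, fun i x hx => ?_⟩
    obtain ⟨a1, a2, a3⟩ := hp3 i x hx
    obtain ⟨b1, b2, b3⟩ := hq3 i x hx
    simp only [map_add, val_add, a1, a2, a3, b1, b2, b3, add_zero, and_self]
  smul_mem' := by
    rintro c p ⟨hp1, hp2, hp3⟩
    refine ⟨Submodule.smul_mem _ c hp1, hp2.smul c, fun i x hx => ?_⟩
    obtain ⟨a1, a2, a3⟩ := hp3 i x hx
    simp only [map_smul, val_smul, a1, a2, a3, mul_zero, and_self]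

/-- The symmetric matrix bubbles of degree `k`: all derivatives of order at most 2 vanish at the
vertices, and `σ` vanishes on the boundary. -/
def bubbleSigma (T : Triangle) (k : ℕ) : Submodule ℝ (Matrix (Fin 2) (Fin 2) Poly) where
  carrier := {σ | σ.IsSymm ∧ ∀ i j, σ i j ∈ polyDeg k ∧ VanishesAtVertices T 2 (σ i j) ∧
    ∀ e, ∀ x ∈ edge T e, val (σ i j) x = 0}
  zero_mem' := ⟨Matrix.isSymm_zero, fun i j => ⟨zero_mem _, VanishesAtVertices.zero T 2,
    fun e x _ => by simp [val_zero]⟩⟩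
  add_mem' := by
    rintro σ τ ⟨hσ, hσ'⟩ ⟨hτ, hτ'⟩
    refine ⟨hσ.add hτ, fun i j => ?_⟩
    obtain ⟨a1, a2, a3⟩ := hσ' i j
    obtain ⟨b1, b2, b3⟩ := hτ' i j
    refine ⟨add_mem a1 b1, a2.add b2, fun e x hx => ?_⟩
    rw [Matrix.add_apply, val_add, a3 e x hx, b3 e x hx, add_zero]
  smul_mem' := by
    rintro c σ ⟨hσ, hσ'⟩
    refine ⟨hσ.smul c, fun i j => ?_⟩
    obtain ⟨a1, a2, a3⟩ := hσ' i j
    refine ⟨Submodule.smul_mem _ c a1, a2.smul c, fun e x hx => ?_⟩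
    rw [Matrix.smul_apply, val_smul, a3 e x hx, mul_zero]

/-- The vector bubbles of degree `d` (used with `d = k - 1`): values and first derivatives vanish
at the vertices. -/
def bubbleQ (T : Triangle) (d : ℕ) : Submodule ℝ (Fin 2 → Poly) where
  carrier := {q | ∀ i, q i ∈ polyDeg d ∧ VanishesAtVertices T 1 (q i)}
  zero_mem' := fun _ => ⟨zero_mem _, VanishesAtVertices.zero T 1⟩
  add_mem' := fun hp hq i => ⟨add_mem (hp i).1 (hq i).1, (hp i).2.add (hq i).2⟩
  smul_mem' := fun c _ hp i => ⟨Submodule.smul_mem _ c (hp i).1, (hp i).2.smul c⟩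

/-- The rigid motions `RM = span {(1, 0), (0, 1), (-y, x)}`. -/
def rigidMotions : Submodule ℝ (Fin 2 → Poly) :=
  Submodule.span ℝ {![1, 0], ![0, 1], ![-MvPolynomial.X 1, MvPolynomial.X 0]}

theorem integrableOn_dot (T : Triangle) (q r : Fin 2 → Poly) :
    IntegrableOn (fun x => ∑ i, val (q i) x * val (r i) x) (region T) := by
  have h : Continuous (fun x => ∑ i, val (q i) x * val (r i) x) :=
    continuous_finsetSum _ fun i _ => (continuous_val (q i)).mul (continuous_val (r i))
  exact h.continuousOn.integrableOn_compact (isCompact_region T)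

/-- The fields whose `RM`-moments on the triangle vanish: `∫_T q · r = 0` for all `r ∈ RM`. -/
def rmPerp (T : Triangle) : Submodule ℝ (Fin 2 → Poly) where
  carrier := {q | ∀ r ∈ rigidMotions, ∫ x in region T, ∑ i, val (q i) x * val (r i) x = 0}
  zero_mem' := fun r _ => by simp [val_zero]
  add_mem' := by
    intro p q hp hq r hr
    have h := integral_add (integrableOn_dot T p r) (integrableOn_dot T q r)
    rw [hp r hr, hq r hr, add_zero] at h
    rw [← h]
    simp only [Pi.add_apply, val_add, add_mul, Finset.sum_add_distrib]
  smul_mem' := by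
    intro c q hq r hr
    have h := integral_const_mul (μ := volume.restrict (region T)) c
      (fun x => ∑ i, val (q i) x * val (r i) x)
    rw [hq r hr, mul_zero] at h
    rw [← h]
    simp only [Pi.smul_apply, val_smul, mul_assoc, Finset.mul_sum]

/-- The `L²(T)` norm of a vector field. -/
def l2Norm (T : Triangle) (q : Fin 2 → Poly) : ℝ :=
  √(∫ x in region T, ∑ i, val (q i) x ^ 2)

/-- The `H¹(T)` seminorm `‖∇σ‖_{L²(T)}` of a matrix field. -/
def h1Seminorm (T : Triangle) (σ : Matrix (Fin 2) (Fin 2) Poly) : ℝ :=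
  √(∫ x in region T, ∑ i, ∑ j, ∑ l, val (partialD l (σ i j)) x ^ 2)

/-- The full `H¹(T)` norm `(‖σ‖²_{L²(T)} + ‖∇σ‖²_{L²(T)})^{1/2}` of a matrix field. -/
def h1Norm (T : Triangle) (σ : Matrix (Fin 2) (Fin 2) Poly) : ℝ :=
  √((∫ x in region T, ∑ i, ∑ j, val (σ i j) x ^ 2) + h1Seminorm T σ ^ 2)

/-- The shape regularity constant of the triangle (the ratio of its diameter to the diameter of its
largest inscribed ball) is at most `κ`. -/
def ShapeRegular (κ : ℝ) (T : Triangle) : Prop :=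
  ∃ (c : Plane) (r : ℝ), 0 < r ∧ Metric.closedBall c r ⊆ region T ∧
    Metric.diam (region T) ≤ κ * (2 * r)

end BubbleComplex

end

noncomputable section

namespace BubbleComplex

/-! ### Polynomials and their derivatives -/

/-! Only surjectivity of the divergence is hard. For the rest: tangential derivatives preserve
vanishing on an edge, so the three boundary conditions on `u` kill its whole Hessian there and
`airy` lands in the matrix bubbles. If `airy u = 0`, then `u` is affine with vanishing value and
gradient at a vertex, hence zero. A symmetric divergence-free `σ` is the Airy field of a polynomial,
by integrating closed one-forms twice. After subtraction of an affine function the potential and its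
gradient vanish at one vertex; they then vanish on all of the boundary, because the Hessian does and
the boundary is connected (`exists_airy_eq`).

Surjectivity is a dimension count on the reference triangle with `k = j + 5`
(`map_div_refTriangle`). A scalar bubble is divisible by the cube of the cubic bubble, so `dim U ≤
j(j-1)/2`. Multiplying by the cubic bubble the symmetric fields of degree `j + 2` that vanish at the
vertices gives `dim Σ ≥ 3(j+3)(j+4)/2 - 9`. Hermite interpolation gives `dim Q ≤ (j+5)(j+6) - 18`,
and orthogonality to the rigid motions costs three more dimensions. By rank-nullity the image of the
divergence has dimension at least `j² + 11j + 9`, which is also the upper bound for the target, so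
the two agree. For `k ≤ 4` the target is zero.

Piola-type transformations, which commute with the divergence and respect bubbles and rigid-motion
moments, carry the result to every triangle (`div_pullMat`, `pullVec_mem_rmPerp`). They also
transport one fixed linear right inverse from the reference triangle. That inverse is bounded
because its domain is finite-dimensional; the distortion is controlled by the entries of the affine
map and of its inverse, bounded by the diameter and by the reciprocal inradius. In the gradient
estimate only their product survives. -/

theorem val_mul (p q : Poly) (x : Plane) : val (p * q) x = val p x * val q x := by simp [val]

theorem val_neg (p : Poly) (x : Plane) : val (-p) x = -val p x := by simp [val]

theorem val_sub (p q : Poly) (x : Plane) : val (p - q) x = val p x - val q x := by simp [val]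

theorem val_one (x : Plane) : val 1 x = 1 := by simp [val]

theorem val_pow (p : Poly) (n : ℕ) (x : Plane) : val (p ^ n) x = val p x ^ n := by simp [val]

theorem val_X (i : Fin 2) (x : Plane) : val (MvPolynomial.X i) x = x i := by simp [val]

theorem val_C (c : ℝ) (x : Plane) : val (MvPolynomial.C c) x = c := by simp [val]

theorem val_sum {ι : Type*} (s : Finset ι) (f : ι → Poly) (x : Plane) :
    val (∑ i ∈ s, f i) x = ∑ i ∈ s, val (f i) x := by simp [val]

theorem eq_zero_of_val {p : Poly} (h : ∀ x, val p x = 0) : p = 0 := by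
  refine MvPolynomial.funext fun y => ?_
  simpa [val] using h (WithLp.toLp 2 y)

theorem partialD_mul (i : Fin 2) (p q : Poly) :
    partialD i (p * q) = partialD i p * q + p * partialD i q := by
  simp [partialD, mul_comm, add_comm]

theorem partialD_C (i : Fin 2) (c : ℝ) : partialD i (MvPolynomial.C c) = 0 := by
  simp [partialD]

theorem partialD_one (i : Fin 2) : partialD i 1 = 0 := by
  simp [partialD]

theorem partialD_X (i j : Fin 2) : partialD i (MvPolynomial.X j) = if i = j then 1 else 0 := by
  simp [partialD, MvPolynomial.pderiv_X, Pi.single_apply, eq_comm]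

theorem partialD_comm (i j : Fin 2) (p : Poly) :
    partialD i (partialD j p) = partialD j (partialD i p) := by
  induction p using MvPolynomial.induction_on with
  | C a => simp [partialD_C]
  | add p q hp hq => simp [hp, hq]
  | mul_X p k hp =>
    simp only [partialD_mul, map_add, partialD_X, hp]
    split_ifs <;> (simp [partialD_one]; try ring)

theorem multiD_zero (p : Poly) : multiD 0 0 p = p := by simp [multiD]

theorem multiD_partialD_zero (a b : ℕ) (p : Poly) :
    multiD a b (partialD 0 p) = multiD (a + 1) b p := by
  have h : Commute (partialD 0) (partialD 1) := LinearMap.ext fun p => partialD_comm 0 1 p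
  have h2 : multiD a b * partialD 0 = multiD (a + 1) b := by
    rw [multiD, multiD, mul_assoc, (h.pow_right b).symm.eq, ← mul_assoc, ← pow_succ]
  exact LinearMap.congr_fun h2 p

theorem multiD_partialD_one (a b : ℕ) (p : Poly) :
    multiD a b (partialD 1 p) = multiD a (b + 1) p := by
  have h2 : multiD a b * partialD 1 = multiD a (b + 1) := by
    rw [multiD, multiD, mul_assoc, ← pow_succ]
  exact LinearMap.congr_fun h2 p

theorem VanishesAtVertices.mono {T : Triangle} {m n : ℕ} (h : m ≤ n) {p : Poly}
    (hp : VanishesAtVertices T n p) : VanishesAtVertices T m p :=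
  fun v a b hab => hp v a b (hab.trans h)

theorem VanishesAtVertices.val_eq_zero {T : Triangle} {m : ℕ} {p : Poly}
    (hp : VanishesAtVertices T m p) (v : Fin 3) : val p (T.points v) = 0 := by
  simpa [multiD_zero] using hp v 0 0 (by simp)

theorem VanishesAtVertices.partialD {T : Triangle} {m : ℕ} {p : Poly}
    (hp : VanishesAtVertices T (m + 1) p) (i : Fin 2) : VanishesAtVertices T m (partialD i p) := by
  intro v a b hab
  fin_cases i
  · simpa [multiD_partialD_zero] using hp v (a + 1) b (by omega)
  · simpa [multiD_partialD_one] using hp v a (b + 1) (by omega)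

/-- The recursive form of the vertex conditions, which makes induction on the order possible without
handling multi-indices. -/
theorem vanishesAtVertices_succ_iff {T : Triangle} {m : ℕ} {p : Poly} :
    VanishesAtVertices T (m + 1) p ↔ (∀ v, val p (T.points v) = 0) ∧
      ∀ i, VanishesAtVertices T m (partialD i p) := by
  refine ⟨fun h => ⟨h.val_eq_zero, h.partialD⟩, fun ⟨h0, h1⟩ v a b hab => ?_⟩
  rcases a with _ | a
  · rcases b with _ | b
    · simpa [multiD_zero] using h0 v
    · simpa [multiD_partialD_one] using h1 1 v 0 b (by omega)
  · simpa [multiD_partialD_zero] using h1 0 v a b (by omega)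

theorem vanishesAtVertices_zero_iff {T : Triangle} {p : Poly} :
    VanishesAtVertices T 0 p ↔ ∀ v, val p (T.points v) = 0 := by
  refine ⟨fun h => h.val_eq_zero, fun h v a b hab => ?_⟩
  obtain ⟨rfl, rfl⟩ : a = 0 ∧ b = 0 := by omega
  simpa [multiD_zero] using h v

theorem VanishesAtVertices.neg {T : Triangle} {m : ℕ} {p : Poly}
    (hp : VanishesAtVertices T m p) : VanishesAtVertices T m (-p) := by
  simpa using hp.smul (-1)

theorem mem_polyDeg {d : ℕ} {p : Poly} : p ∈ polyDeg d ↔ p.totalDegree ≤ d :=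
  MvPolynomial.mem_restrictTotalDegree _ _ _

theorem polyDeg_mono {d e : ℕ} (h : d ≤ e) {p : Poly} (hp : p ∈ polyDeg d) : p ∈ polyDeg e :=
  mem_polyDeg.2 ((mem_polyDeg.1 hp).trans h)

theorem monomial_mem_polyDeg {d : ℕ} {s : Fin 2 →₀ ℕ} (hs : s 0 + s 1 ≤ d) (c : ℝ) :
    MvPolynomial.monomial s c ∈ polyDeg d := by
  refine mem_polyDeg.2 ((MvPolynomial.totalDegree_monomial_le s c).trans ?_)
  simpa [Finsupp.sum_fintype] using hs

theorem mul_mem_polyDeg {d e : ℕ} {p q : Poly} (hp : p ∈ polyDeg d) (hq : q ∈ polyDeg e) :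
    p * q ∈ polyDeg (d + e) := by
  rw [mem_polyDeg] at *
  exact (MvPolynomial.totalDegree_mul p q).trans (add_le_add hp hq)

theorem C_mem_polyDeg (d : ℕ) (c : ℝ) : MvPolynomial.C c ∈ polyDeg d := by
  simp [mem_polyDeg]

theorem X_mem_polyDeg (i : Fin 2) : (MvPolynomial.X i : Poly) ∈ polyDeg 1 := by
  simp [mem_polyDeg]

/-- Monomials span, so a degree bound for a linear operator need only be tested on them; this serves
derivatives, antiderivatives and substitutions. -/
theorem map_mem_polyDeg {d e : ℕ} (f : Poly →ₗ[ℝ] Poly)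
    (hf : ∀ s : Fin 2 →₀ ℕ, s 0 + s 1 ≤ d → f (MvPolynomial.monomial s 1) ∈ polyDeg e)
    {p : Poly} (hp : p ∈ polyDeg d) : f p ∈ polyDeg e := by
  rw [polyDeg, MvPolynomial.restrictTotalDegree, MvPolynomial.restrictSupport_eq_span] at hp
  refine Submodule.span_le (p := (polyDeg e).comap f) |>.2 ?_ hp
  rintro _ ⟨s, hs, rfl⟩
  exact hf s (by simpa [Finsupp.sum_fintype] using hs)

theorem partialD_mem_polyDeg {d : ℕ} {p : Poly} (hp : p ∈ polyDeg d) (i : Fin 2) :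
    partialD i p ∈ polyDeg (d - 1) := by
  refine map_mem_polyDeg _ (fun s hs => ?_) hp
  simp only [partialD, Derivation.coeFn_coe, MvPolynomial.pderiv_monomial]
  -- If the exponent is zero the derivative vanishes; otherwise `d ≥ 1`, so the truncated `d - 1` is
  -- the true difference.
  by_cases h : s i = 0
  · simp [h]
  · refine monomial_mem_polyDeg ?_ _
    fin_cases i <;> simp at h ⊢ <;> omega

/-! ### Restriction to lines -/

/-- The restriction of a polynomial to the line `s ↦ x + s d`. -/
def lineRes (x d : Plane) : Poly →ₐ[ℝ] Polynomial ℝ :=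
  MvPolynomial.aeval fun i => Polynomial.C (x i) + Polynomial.C (d i) * Polynomial.X

/-- The derivative in the direction `d`. -/
def dirD (d : Plane) : Module.End ℝ Poly := d 0 • partialD 0 + d 1 • partialD 1

theorem dirD_apply (d : Plane) (p : Poly) :
    dirD d p = d 0 • partialD 0 p + d 1 • partialD 1 p := rfl

theorem eval_lineRes (x d : Plane) (p : Poly) (s : ℝ) :
    (lineRes x d p).eval s = val p (x + s • d) := by
  induction p using MvPolynomial.induction_on with
  | C a => simp [lineRes, val_C]
  | add p q hp hq => simp [hp, hq, val_add]
  | mul_X p k hp =>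
    rw [map_mul, Polynomial.eval_mul, hp, val_mul, val_X]
    simp [lineRes, mul_comm s]

/-- The chain rule; it reduces questions along an edge to polynomials in one variable. -/
theorem derivative_lineRes (x d : Plane) (p : Poly) :
    Polynomial.derivative (lineRes x d p) = lineRes x d (dirD d p) := by
  induction p using MvPolynomial.induction_on with
  | C a => simp [lineRes, dirD_apply, partialD_C]
  | add p q hp hq => simp [hp, hq]
  | mul_X p k hp =>
    have hX : lineRes x d (MvPolynomial.X k) =
        Polynomial.C (x k) + Polynomial.C (d k) * Polynomial.X := by simp [lineRes]
    have : dirD d (p * MvPolynomial.X k) =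
        dirD d p * MvPolynomial.X k + MvPolynomial.C (d k) * p := by
      simp only [dirD_apply, partialD_mul, partialD_X, MvPolynomial.smul_eq_C_mul]
      fin_cases k <;> simp <;> ring
    have hC : lineRes x d (MvPolynomial.C (d k)) = Polynomial.C (d k) := by simp [lineRes]
    rw [this]
    simp only [map_mul, map_add, Polynomial.derivative_mul, hp, hX, hC]
    simp
    ring

theorem val_eq_of_dirD_eq_zero {x d : Plane} {p : Poly} (h : lineRes x d (dirD d p) = 0) (s : ℝ) :
    val p (x + s • d) = val p x := by
  rw [← derivative_lineRes] at h
  have h1 := Polynomial.eq_C_of_derivative_eq_zero h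
  have h2 := eval_lineRes x d p 0
  have h3 := eval_lineRes x d p s
  rw [h1] at h2 h3
  simp only [Polynomial.eval_C, zero_smul, add_zero] at h2 h3
  rw [← h3, h2]

theorem eq_zero_of_partialD_eq_zero {p : Poly} (h : ∀ i, partialD i p = 0) {v : Plane}
    (hv : val p v = 0) : p = 0 := by
  refine eq_zero_of_val fun x => ?_
  have := val_eq_of_dirD_eq_zero (x := v) (d := x - v) (p := p) (by simp [dirD_apply, h]) 1
  simpa [hv] using this

theorem edge_eq (T : Triangle) (e : Fin 3) :
    edge T e = (fun s : ℝ => T.points (e + 1) + s • edgeVec T e) '' Set.Icc 0 1 :=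
  segment_eq_image' ℝ _ _

theorem points_succ_mem_edge (T : Triangle) (e : Fin 3) : T.points (e + 1) ∈ edge T e :=
  left_mem_segment _ _ _

theorem points_add_two_mem_edge (T : Triangle) (e : Fin 3) : T.points (e + 2) ∈ edge T e :=
  right_mem_segment _ _ _

/-- The polynomials that vanish on an edge. -/
def edgeVanishing (T : Triangle) (e : Fin 3) : Submodule ℝ Poly where
  carrier := {p | ∀ x ∈ edge T e, val p x = 0}
  zero_mem' := fun x _ => val_zero x
  add_mem' := fun hp hq x hx => by rw [val_add, hp x hx, hq x hx, add_zero]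
  smul_mem' := fun c p hp x hx => by rw [val_smul, hp x hx, mul_zero]

theorem mem_edgeVanishing {T : Triangle} {e : Fin 3} {p : Poly} :
    p ∈ edgeVanishing T e ↔ ∀ x ∈ edge T e, val p x = 0 := Iff.rfl

/-- A one-variable polynomial with infinitely many zeros is zero. Vanishing on an edge thus becomes
membership in the kernel of an algebra homomorphism, which is stable under tangential derivatives
and, the codomain being a domain, prime. -/
theorem mem_edgeVanishing_iff_lineRes {T : Triangle} {e : Fin 3} {p : Poly} :
    p ∈ edgeVanishing T e ↔ lineRes (T.points (e + 1)) (edgeVec T e) p = 0 := by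
  rw [mem_edgeVanishing, edge_eq, Set.forall_mem_image]
  simp only [← eval_lineRes]
  constructor
  · intro h
    refine Polynomial.eq_zero_of_infinite_isRoot _ ((Set.Icc_infinite zero_lt_one).mono ?_)
    exact fun s hs => h hs
  · intro h s _
    simp [h]

theorem dirD_mem_edgeVanishing {T : Triangle} {e : Fin 3} {p : Poly} (hp : p ∈ edgeVanishing T e) :
    dirD (edgeVec T e) p ∈ edgeVanishing T e := by
  rw [mem_edgeVanishing_iff_lineRes] at *
  rw [← derivative_lineRes, hp, Polynomial.derivative_zero]

theorem val_eq_of_dirD_mem {T : Triangle} {e : Fin 3} {p : Poly}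
    (hp : dirD (edgeVec T e) p ∈ edgeVanishing T e) {x : Plane} (hx : x ∈ edge T e) :
    val p x = val p (T.points (e + 1)) := by
  rw [mem_edgeVanishing_iff_lineRes] at hp
  rw [edge_eq] at hx
  obtain ⟨s, _, rfl⟩ := hx
  exact val_eq_of_dirD_eq_zero hp s

/-- Connectedness of the boundary: the polynomial is constant along each edge, neighbouring edges
share a vertex, and the common constant is zero. -/
theorem mem_edgeVanishing_of_dirD_mem {T : Triangle} {p : Poly}
    (hp : ∀ e, dirD (edgeVec T e) p ∈ edgeVanishing T e) (h0 : val p (T.points 0) = 0) (e : Fin 3) :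
    p ∈ edgeVanishing T e := by
  have step : ∀ e, val p (T.points (e + 1)) = val p (T.points (e + 2)) := fun e =>
    (val_eq_of_dirD_mem (hp e) (points_add_two_mem_edge T e)).symm
  have h2 : val p (T.points 2) = 0 := by rw [← h0]; exact step 1
  have h1 : val p (T.points 1) = 0 := by rw [← h2]; exact step 0
  intro x hx
  rw [val_eq_of_dirD_mem (hp e) hx]
  fin_cases e
  · exact h1
  · exact h2
  · exact h0

theorem edgeVec_ne_zero (T : Triangle) (e : Fin 3) : edgeVec T e ≠ 0 := by
  rw [edgeVec, sub_ne_zero]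
  refine T.independent.injective.ne ?_
  fin_cases e <;> decide

theorem edgeVec_sq (T : Triangle) (e : Fin 3) :
    edgeVec T e 0 ^ 2 + edgeVec T e 1 ^ 2 = ‖edgeVec T e‖ ^ 2 := by
  simp [EuclideanSpace.norm_sq_eq]

/-- The edge vector and the unit normal form an orthogonal basis. The edge vector is not normalized,
hence the division by its squared length in the tangential coefficient. -/
theorem partialD_eq_frame (T : Triangle) (e : Fin 3) (i : Fin 2) : ∃ a b : ℝ,
    partialD i = a • dirD (edgeVec T e) + b • normalD T e := by
  have h := edgeVec_sq T e
  have hn : ‖edgeVec T e‖ ≠ 0 := norm_ne_zero_iff.mpr (edgeVec_ne_zero T e)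
  have key : ∀ a b : ℝ, ∀ p, (a • dirD (edgeVec T e) + b • normalD T e) p =
      (a * edgeVec T e 0 + b * (‖edgeVec T e‖⁻¹ * edgeVec T e 1)) • partialD 0 p +
      (a * edgeVec T e 1 - b * (‖edgeVec T e‖⁻¹ * edgeVec T e 0)) • partialD 1 p := by
    intro a b p
    simp [dirD, normalD, edgeNormal]
    module
  set d0 := edgeVec T e 0
  set d1 := edgeVec T e 1
  set N := ‖edgeVec T e‖
  fin_cases i
  · refine ⟨d0 / N ^ 2, d1 / N, LinearMap.ext fun p => ?_⟩
    rw [key]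
    have e1 : d0 / N ^ 2 * d0 + d1 / N * (N⁻¹ * d1) = 1 := by
      field_simp; linarith
    have e2 : d0 / N ^ 2 * d1 - d1 / N * (N⁻¹ * d0) = 0 := by
      field_simp; ring
    simp [e1, e2]
  · refine ⟨d1 / N ^ 2, -d0 / N, LinearMap.ext fun p => ?_⟩
    rw [key]
    have e1 : d1 / N ^ 2 * d1 - -d0 / N * (N⁻¹ * d0) = 1 := by
      field_simp; linarith
    have e2 : d1 / N ^ 2 * d0 + -d0 / N * (N⁻¹ * d1) = 0 := by
      field_simp; ring
    simp [e1, e2]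

theorem dirD_normalD (T : Triangle) (e : Fin 3) (d : Plane) (p : Poly) :
    dirD d (normalD T e p) = normalD T e (dirD d p) := by
  simp only [dirD, normalD, LinearMap.add_apply, LinearMap.smul_apply, map_add, map_smul,
    partialD_comm 0 1]
  module

/-- In the tangent-normal frame, second derivatives are tangential derivatives of `u` and of its
normal derivative, or the second normal derivative. -/
theorem partialD_partialD_mem_edgeVanishing {T : Triangle} {e : Fin 3} {u : Poly}
    (h0 : u ∈ edgeVanishing T e) (h1 : normalD T e u ∈ edgeVanishing T e)
    (h2 : normalD T e (normalD T e u) ∈ edgeVanishing T e) (i j : Fin 2) :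
    partialD i (partialD j u) ∈ edgeVanishing T e := by
  obtain ⟨a, b, hi⟩ := partialD_eq_frame T e i
  obtain ⟨c, d, hj⟩ := partialD_eq_frame T e j
  rw [hi, hj]
  have h3 := dirD_mem_edgeVanishing h1
  have h4 := dirD_mem_edgeVanishing (dirD_mem_edgeVanishing h0)
  have h5 := h3
  rw [dirD_normalD] at h5
  simp only [LinearMap.add_apply, LinearMap.smul_apply, map_add, map_smul]
  refine add_mem (Submodule.smul_mem _ _ (add_mem ?_ ?_))
    (Submodule.smul_mem _ _ (add_mem ?_ ?_))
  exacts [Submodule.smul_mem _ _ h4, Submodule.smul_mem _ _ h5, Submodule.smul_mem _ _ h3,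
    Submodule.smul_mem _ _ h2]

/-! ### Antiderivatives -/

/-- The antiderivative in the variable `x_i` that vanishes for `x_i = 0`. -/
def antiD (i : Fin 2) : Module.End ℝ Poly :=
  (MvPolynomial.basisMonomials (Fin 2) ℝ).constr ℝ fun s =>
    MvPolynomial.monomial (s + Finsupp.single i 1) ((s i : ℝ) + 1)⁻¹

theorem antiD_monomial (i : Fin 2) (s : Fin 2 →₀ ℕ) :
    antiD i (MvPolynomial.monomial s 1) =
      MvPolynomial.monomial (s + Finsupp.single i 1) ((s i : ℝ) + 1)⁻¹ :=
  (MvPolynomial.basisMonomials (Fin 2) ℝ).constr_basis ℝ _ s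

theorem antiD_monomial' (i : Fin 2) (s : Fin 2 →₀ ℕ) (c : ℝ) :
    antiD i (MvPolynomial.monomial s c) =
      MvPolynomial.monomial (s + Finsupp.single i 1) (c * ((s i : ℝ) + 1)⁻¹) := by
  have : MvPolynomial.monomial s c = c • MvPolynomial.monomial s (1 : ℝ) := by
    simp [MvPolynomial.smul_monomial]
  rw [this, map_smul, antiD_monomial, MvPolynomial.smul_monomial, smul_eq_mul]

theorem partialD_antiD (i : Fin 2) (p : Poly) : partialD i (antiD i p) = p := by
  suffices h : partialD i ∘ₗ antiD i = LinearMap.id from LinearMap.congr_fun h p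
  refine (MvPolynomial.basisMonomials (Fin 2) ℝ).ext fun s => ?_
  have : (s i : ℝ) + 1 ≠ 0 := by positivity
  simp [antiD_monomial, partialD, MvPolynomial.pderiv_monomial, this]

theorem partialD_antiD_of_ne {i j : Fin 2} (hij : i ≠ j) (p : Poly) :
    partialD i (antiD j p) = antiD j (partialD i p) := by
  suffices h : partialD i ∘ₗ antiD j = antiD j ∘ₗ partialD i from LinearMap.congr_fun h p
  refine (MvPolynomial.basisMonomials (Fin 2) ℝ).ext fun s => ?_
  simp only [MvPolynomial.coe_basisMonomials, LinearMap.comp_apply, partialD,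
    Derivation.coeFn_coe, MvPolynomial.pderiv_monomial, antiD_monomial']
  by_cases h : s i = 0
  · simp [h, hij.symm]
  · have e1 : s + Finsupp.single j 1 - Finsupp.single i 1 =
        s - Finsupp.single i 1 + Finsupp.single j 1 := by
      refine Finsupp.ext fun l => ?_
      simp only [Finsupp.add_apply, Finsupp.tsub_apply, Finsupp.single_apply]
      split_ifs <;> omega
    rw [e1]
    simp [hij, hij.symm, mul_comm]

theorem antiD_mem_polyDeg {d : ℕ} {p : Poly} (hp : p ∈ polyDeg d) (i : Fin 2) :
    antiD i p ∈ polyDeg (d + 1) := by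
  refine map_mem_polyDeg _ (fun s hs => ?_) hp
  rw [antiD_monomial]
  refine monomial_mem_polyDeg ?_ _
  fin_cases i <;> simp <;> omega

/-- Closed polynomial one-forms in the plane are exact. -/
theorem exists_potential {d : ℕ} {f g : Poly} (hf : f ∈ polyDeg d) (hg : g ∈ polyDeg d)
    (h : partialD 1 f = partialD 0 g) :
    ∃ u ∈ polyDeg (d + 1), partialD 0 u = f ∧ partialD 1 u = g := by
  have h1 : partialD 1 (antiD 0 f) = antiD 0 (partialD 0 g) := by
    rw [partialD_antiD_of_ne (by decide), h]
  -- The first term has the right `x`-derivative. By closedness the remaining error in the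
  -- `y`-derivative does not depend on `x`, so integrating it in `y` leaves the `x`-derivative
  -- intact.
  refine ⟨antiD 0 f + antiD 1 (g - partialD 1 (antiD 0 f)), add_mem (antiD_mem_polyDeg hf 0)
    (antiD_mem_polyDeg (sub_mem hg ?_) 1), ?_, ?_⟩
  · simpa using partialD_mem_polyDeg (antiD_mem_polyDeg hf 0) 1
  · rw [map_add, partialD_antiD, partialD_antiD_of_ne (by decide), map_sub, h1, partialD_antiD]
    simp
  · rw [map_add, partialD_antiD]
    abel

/-! ### The Airy operator on bubbles -/

theorem airy_apply (u : Poly) (i j : Fin 2) : airy u i j = curlComp i (curlComp j u) := rfl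

theorem airy_eq (u : Poly) : airy u =
    !![partialD 1 (partialD 1 u), -partialD 0 (partialD 1 u);
      -partialD 0 (partialD 1 u), partialD 0 (partialD 0 u)] := by
  ext1 i j
  fin_cases i <;> fin_cases j <;> simp [airy_apply, curlComp, partialD_comm 1 0]

theorem airy_mem_bubbleSigma {T : Triangle} {k : ℕ} {u : Poly} (hu : u ∈ bubbleU T (k + 2)) :
    airy u ∈ bubbleSigma T k := by
  obtain ⟨h1, h2, h3⟩ := hu
  have key : ∀ i j, partialD i (partialD j u) ∈ polyDeg k ∧
      VanishesAtVertices T 2 (partialD i (partialD j u)) ∧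
      ∀ e, ∀ x ∈ edge T e, val (partialD i (partialD j u)) x = 0 := fun i j =>
    ⟨partialD_mem_polyDeg (partialD_mem_polyDeg h1 j) i, (h2.partialD j).partialD i, fun e =>
      partialD_partialD_mem_edgeVanishing (fun x hx => (h3 e x hx).1)
        (fun x hx => (h3 e x hx).2.1) (fun x hx => (h3 e x hx).2.2) i j⟩
  have key' : ∀ i j, -partialD i (partialD j u) ∈ polyDeg k ∧
      VanishesAtVertices T 2 (-partialD i (partialD j u)) ∧
      ∀ e, ∀ x ∈ edge T e, val (-partialD i (partialD j u)) x = 0 := fun i j =>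
    ⟨neg_mem (key i j).1, (key i j).2.1.neg, fun e x hx => by
      rw [val_neg, (key i j).2.2 e x hx, neg_zero]⟩
  rw [airy_eq]
  refine ⟨Matrix.IsSymm.ext fun i j => by fin_cases i <;> fin_cases j <;> rfl, fun i j => ?_⟩
  fin_cases i <;> fin_cases j
  exacts [key 1 1, key' 0 1, key' 0 1, key 0 0]

theorem eq_zero_of_airy_eq_zero {T : Triangle} {d : ℕ} {u : Poly} (hu : u ∈ bubbleU T d)
    (h : airy u = 0) : u = 0 := by
  rw [airy_eq] at h
  have h11 : partialD 1 (partialD 1 u) = 0 := congr_fun₂ h 0 0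
  have h01 : partialD 0 (partialD 1 u) = 0 := neg_eq_zero.1 (congr_fun₂ h 0 1)
  have h00 : partialD 0 (partialD 0 u) = 0 := congr_fun₂ h 1 1
  have h10 : partialD 1 (partialD 0 u) = 0 := by rw [partialD_comm, h01]
  refine eq_zero_of_partialD_eq_zero (v := T.points 0) (fun i => ?_) (hu.2.1.val_eq_zero 0)
  refine eq_zero_of_partialD_eq_zero (v := T.points 0) (fun j => ?_)
    ((hu.2.1.partialD i).val_eq_zero 0)
  fin_cases i <;> fin_cases j
  exacts [h00, h10, h01, h11]

theorem div_apply (σ : Matrix (Fin 2) (Fin 2) Poly) (i : Fin 2) :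
    div σ i = ∑ j, partialD j (σ i j) := rfl

theorem div_airy (u : Poly) : div (airy u) = 0 := by
  ext1 i
  rw [div_apply, airy_eq]
  fin_cases i <;>
    simp [partialD_comm 1 0, Fin.sum_univ_two]

/-- Boundary connectedness is used twice: from the Hessian to the gradient, then from the gradient
to `u`. Each integration also raises the vertex order by one, from 2 to 4. -/
theorem bubbleU_of_partialD_partialD {T : Triangle} {d : ℕ} {u : Poly} (hd : u ∈ polyDeg d)
    (hu : val u (T.points 0) = 0) (hu' : ∀ i, val (partialD i u) (T.points 0) = 0)
    (h : ∀ i j, VanishesAtVertices T 2 (partialD i (partialD j u)))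
    (h' : ∀ i j e, partialD i (partialD j u) ∈ edgeVanishing T e) : u ∈ bubbleU T d := by
  have h1 : ∀ i e, partialD i u ∈ edgeVanishing T e := fun i =>
    mem_edgeVanishing_of_dirD_mem (fun e => add_mem (Submodule.smul_mem _ _ (h' 0 i e))
      (Submodule.smul_mem _ _ (h' 1 i e))) (hu' i)
  have h0 : ∀ e, u ∈ edgeVanishing T e :=
    mem_edgeVanishing_of_dirD_mem (fun e => add_mem (Submodule.smul_mem _ _ (h1 0 e))
      (Submodule.smul_mem _ _ (h1 1 e))) hu
  have vert : ∀ p, (∀ e, p ∈ edgeVanishing T e) → ∀ v, val p (T.points v) = 0 := by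
    intro p hp v
    have := hp (v - 1) _ (points_succ_mem_edge T (v - 1))
    rwa [sub_add_cancel] at this
  refine ⟨hd, vanishesAtVertices_succ_iff.2 ⟨vert _ h0, fun i =>
    vanishesAtVertices_succ_iff.2 ⟨vert _ (h1 i), fun j => h j i⟩⟩, fun e x hx =>
    ⟨h0 e x hx, ?_, ?_⟩⟩
  · have : normalD T e u ∈ edgeVanishing T e := add_mem (Submodule.smul_mem _ _ (h1 0 e))
      (Submodule.smul_mem _ _ (h1 1 e))
    exact this x hx
  · have hh : ∀ i, partialD i (normalD T e u) ∈ edgeVanishing T e := fun i => by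
      simp only [normalD, LinearMap.add_apply, LinearMap.smul_apply, map_add, map_smul]
      exact add_mem (Submodule.smul_mem _ _ (h' i 0 e)) (Submodule.smul_mem _ _ (h' i 1 e))
    have : normalD T e (normalD T e u) ∈ edgeVanishing T e :=
      add_mem (Submodule.smul_mem _ _ (hh 0)) (Submodule.smul_mem _ _ (hh 1))
    exact this x hx

/-- The two rows of the equation `div σ = 0` are closedness conditions for two one-forms, and
symmetry of `σ` makes the pair of their potentials closed again. -/
theorem exists_airy_eq {T : Triangle} {k : ℕ} {σ : Matrix (Fin 2) (Fin 2) Poly}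
    (hσ : σ ∈ bubbleSigma T k) (h : div σ = 0) : ∃ u ∈ bubbleU T (k + 2), airy u = σ := by
  obtain ⟨hsymm, hσ'⟩ := hσ
  have h10 : σ 1 0 = σ 0 1 := hsymm.apply 0 1
  have r0 : partialD 0 (σ 0 0) + partialD 1 (σ 0 1) = 0 := by
    simpa [div_apply, Fin.sum_univ_two] using congr_fun h 0
  have r1 : partialD 0 (σ 0 1) + partialD 1 (σ 1 1) = 0 := by
    simpa [div_apply, Fin.sum_univ_two, h10] using congr_fun h 1
  -- Here `a` plays the role of `u_y` and `b` that of `u_x`.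
  obtain ⟨a, ha, ha0, ha1⟩ := exists_potential (neg_mem (hσ' 0 1).1) (hσ' 0 0).1
    (by rw [map_neg]; linear_combination -r0)
  obtain ⟨b, hb, hb0, hb1⟩ := exists_potential (hσ' 1 1).1 (neg_mem (hσ' 0 1).1)
    (by rw [map_neg]; linear_combination r1)
  obtain ⟨w, hw, hw0, hw1⟩ := exists_potential hb ha (by rw [hb1, ha0])
  set v := T.points 0
  -- The first-order Taylor polynomial of `w` at the vertex; removing it normalizes value and
  -- gradient without changing second derivatives.
  set l : Poly := MvPolynomial.C (val w v) +
    MvPolynomial.C (val b v) * (MvPolynomial.X 0 - MvPolynomial.C (v 0)) +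
    MvPolynomial.C (val a v) * (MvPolynomial.X 1 - MvPolynomial.C (v 1)) with hl
  have hlv : val l v = val w v := by
    simp [hl, val_add, val_mul, val_sub, val_X, val_C]
  have hl0 : partialD 0 l = MvPolynomial.C (val b v) := by
    simp [hl, partialD_mul, partialD_C, partialD_X]
  have hl1 : partialD 1 l = MvPolynomial.C (val a v) := by
    simp [hl, partialD_mul, partialD_C, partialD_X]
  have hld : l ∈ polyDeg 1 := by
    have aux : ∀ (c c' : ℝ) (i : Fin 2),
        MvPolynomial.C c * (MvPolynomial.X i - MvPolynomial.C c') ∈ polyDeg 1 := fun c c' i => by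
      simpa using mul_mem_polyDeg (C_mem_polyDeg 0 c)
        (sub_mem (X_mem_polyDeg i) (C_mem_polyDeg 1 c'))
    exact add_mem (add_mem (C_mem_polyDeg _ _) (aux _ _ _)) (aux _ _ _)
  have d00 : partialD 0 (partialD 0 (w - l)) = σ 1 1 := by
    simp [hl0, hw0, partialD_C, hb0]
  have d10 : partialD 1 (partialD 0 (w - l)) = -σ 0 1 := by
    simp [hl0, hw0, partialD_C, hb1]
  have d01 : partialD 0 (partialD 1 (w - l)) = -σ 0 1 := by
    simp [hl1, hw1, partialD_C, ha0]
  have d11 : partialD 1 (partialD 1 (w - l)) = σ 0 0 := by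
    simp [hl1, hw1, partialD_C, ha1]
  have hv : val (w - l) v = 0 := by rw [val_sub, hlv, sub_self]
  have hv' : ∀ i, val (partialD i (w - l)) v = 0 := by
    intro i
    fin_cases i
    · simp [hw0, hl0, val_sub, val_C]
    · simp [hw1, hl1, val_sub, val_C]
  have hz := sub_mem hw (polyDeg_mono (d := 1) (by omega) hld)
  generalize w - l = z at *
  refine ⟨z, bubbleU_of_partialD_partialD hz hv hv' (fun i j => ?_) (fun i j e => ?_), ?_⟩
  · fin_cases i <;> fin_cases j
    · simpa [d00] using (hσ' 1 1).2.1
    · simpa [d01] using (hσ' 0 1).2.1.neg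
    · simpa [d10] using (hσ' 0 1).2.1.neg
    · simpa [d11] using (hσ' 0 0).2.1
  · have hE : ∀ i j, σ i j ∈ edgeVanishing T e := fun i j => (hσ' i j).2.2 e
    fin_cases i <;> fin_cases j
    · simpa [d00] using hE 1 1
    · simpa [d01] using hE 0 1
    · simpa [d10] using hE 0 1
    · simpa [d11] using hE 0 0
  · rw [airy_eq, d11, d01, d00]
    ext1 i j
    fin_cases i <;> fin_cases j <;> simp [h10]

/-! ### Affine changes of variables -/

theorem pow_mem_polyDeg {p : Poly} (hp : p ∈ polyDeg 1) (n : ℕ) : p ^ n ∈ polyDeg n := by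
  induction n with
  | zero => simp [mem_polyDeg]
  | succ n ih => exact pow_succ p n ▸ mul_mem_polyDeg ih hp

/-- The linear map `x ↦ M x` of the plane. -/
def linMap (M : Matrix (Fin 2) (Fin 2) ℝ) : Plane →ₗ[ℝ] Plane where
  toFun x := WithLp.toLp 2 (fun i => ∑ j, M i j * x j)
  map_add' x y := by ext i; simp [mul_add, Finset.sum_add_distrib]
  map_smul' a x := by ext i; simp only [PiLp.smul_apply, smul_eq_mul, Finset.mul_sum,
    RingHom.id_apply, mul_left_comm]

/-- The affine map `x ↦ c + M x` of the plane. -/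
def affMap (M : Matrix (Fin 2) (Fin 2) ℝ) (c : Plane) : Plane →ᵃ[ℝ] Plane :=
  AffineMap.const ℝ Plane c + (linMap M).toAffineMap

theorem affMap_eq (M : Matrix (Fin 2) (Fin 2) ℝ) (c x : Plane) :
    affMap M c x = c + linMap M x := rfl

theorem affMap_apply (M : Matrix (Fin 2) (Fin 2) ℝ) (c x : Plane) (i : Fin 2) :
    affMap M c x i = c i + ∑ j, M i j * x j := rfl

/-- Composition of polynomials with the affine map `x ↦ c + M x`. -/
def pull (M : Matrix (Fin 2) (Fin 2) ℝ) (c : Plane) : Poly →ₐ[ℝ] Poly :=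
  MvPolynomial.aeval fun i => MvPolynomial.C (c i) + ∑ j, MvPolynomial.C (M i j) * MvPolynomial.X j

section

variable (M : Matrix (Fin 2) (Fin 2) ℝ) (c : Plane)

theorem pull_X (i : Fin 2) : pull M c (MvPolynomial.X i) =
    MvPolynomial.C (c i) + ∑ j, MvPolynomial.C (M i j) * MvPolynomial.X j := by
  simp [pull]

theorem pull_C (a : ℝ) : pull M c (MvPolynomial.C a) = MvPolynomial.C a := by
  simp [pull]

theorem val_pull (p : Poly) (x : Plane) : val (pull M c p) x = val p (affMap M c x) := by
  induction p using MvPolynomial.induction_on with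
  | C a => rw [pull_C, val_C, val_C]
  | add p q hp hq => rw [map_add, val_add, val_add, hp, hq]
  | mul_X p k hp =>
    rw [map_mul, val_mul, hp, val_mul, pull_X, val_add, val_sum, val_X, val_C, affMap_apply]
    simp [val_mul, val_C, val_X]

theorem partialD_pull (j : Fin 2) (p : Poly) :
    partialD j (pull M c p) = ∑ i, M i j • pull M c (partialD i p) := by
  induction p using MvPolynomial.induction_on with
  | C a => simp [partialD_C]
  | add p q hp hq => simp only [map_add, hp, hq, smul_add, Finset.sum_add_distrib]
  | mul_X p k hp =>
    have h : partialD j (pull M c (MvPolynomial.X k)) = MvPolynomial.C (M k j) := by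
      rw [pull_X]
      fin_cases j <;> simp [partialD_C, partialD_mul, partialD_X]
    rw [map_mul, partialD_mul, hp, h]
    simp only [partialD_mul, map_add, map_mul, partialD_X, Fin.sum_univ_two,
      MvPolynomial.smul_eq_C_mul]
    fin_cases k <;> simp <;> ring

theorem pull_mem_polyDeg {d : ℕ} {p : Poly} (hp : p ∈ polyDeg d) : pull M c p ∈ polyDeg d := by
  refine map_mem_polyDeg (pull M c).toLinearMap (fun s hs => ?_) hp
  have h : ∀ i, MvPolynomial.C (c i) + ∑ j, MvPolynomial.C (M i j) * MvPolynomial.X j ∈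
      polyDeg 1 := fun i =>
    add_mem (C_mem_polyDeg _ _) (sum_mem fun j _ => by
      simpa using mul_mem_polyDeg (C_mem_polyDeg 0 _) (X_mem_polyDeg j))
  rw [AlgHom.toLinearMap_apply, pull, MvPolynomial.aeval_monomial, map_one, one_mul,
    Finsupp.prod_fintype _ _ (by simp), Fin.prod_univ_two]
  exact polyDeg_mono hs (mul_mem_polyDeg (pow_mem_polyDeg (h 0) _) (pow_mem_polyDeg (h 1) _))

variable {M c}

theorem VanishesAtVertices.sum {ι : Type*} {T : Triangle} {m : ℕ} {s : Finset ι} {f : ι → Poly}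
    (h : ∀ i ∈ s, VanishesAtVertices T m (f i)) : VanishesAtVertices T m (∑ i ∈ s, f i) :=
  Finset.sum_induction f (VanishesAtVertices T m) (fun _ _ => .add) (.zero T m) h

theorem VanishesAtVertices.pull {S T : Triangle} (h : ∀ v, affMap M c (S.points v) = T.points v)
    {m : ℕ} {p : Poly} (hp : VanishesAtVertices T m p) :
    VanishesAtVertices S m (pull M c p) := by
  induction m generalizing p with
  | zero =>
    rw [vanishesAtVertices_zero_iff] at *
    intro v
    rw [val_pull, h, hp]
  | succ m ih =>
    rw [vanishesAtVertices_succ_iff] at *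
    refine ⟨fun v => by rw [val_pull, h, hp.1], fun j => ?_⟩
    rw [partialD_pull]
    exact VanishesAtVertices.sum fun i _ => (ih (hp.2 i)).smul _

theorem pull_mem_edgeVanishing {S T : Triangle} (h : ∀ v, affMap M c (S.points v) = T.points v)
    {e : Fin 3} {p : Poly} (hp : p ∈ edgeVanishing T e) : pull M c p ∈ edgeVanishing S e := by
  intro x hx
  rw [val_pull]
  refine hp _ ?_
  rw [edge, ← h, ← h, ← image_segment]
  exact Set.mem_image_of_mem _ hx

theorem region_eq_image {S T : Triangle} (h : ∀ v, affMap M c (S.points v) = T.points v) :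
    region T = affMap M c '' region S := by
  rw [region, region, AffineMap.image_convexHull, ← Set.range_comp]
  congr 2
  exact funext fun v => (h v).symm

end

theorem linMap_linMap (M N : Matrix (Fin 2) (Fin 2) ℝ) : linMap M ∘ₗ linMap N = linMap (M * N) := by
  ext1 x
  ext i
  simp [linMap, Matrix.mul_apply, Fin.sum_univ_two]
  ring

theorem linMap_one : linMap 1 = LinearMap.id := by
  ext1 x
  ext i
  simp [linMap, Matrix.one_apply]

theorem affMap_inverse {M N : Matrix (Fin 2) (Fin 2) ℝ} (h : M * N = 1) (c x : Plane) :
    affMap M c (affMap N (-linMap N c) x) = x := by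
  have h' : ∀ y, linMap M (linMap N y) = y := fun y => by
    simpa [h, linMap_one] using LinearMap.congr_fun (linMap_linMap M N) y
  simp [affMap_eq, h']

theorem affMap_inverse' {M N : Matrix (Fin 2) (Fin 2) ℝ} (h : N * M = 1) (c x : Plane) :
    affMap N (-linMap N c) (affMap M c x) = x := by
  have h' : ∀ y, linMap N (linMap M y) = y := fun y => by
    simpa [h, linMap_one] using LinearMap.congr_fun (linMap_linMap N M) y
  simp [affMap_eq, h']

theorem det_linMap_ne_zero {M N : Matrix (Fin 2) (Fin 2) ℝ} (h : M * N = 1) :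
    LinearMap.det (linMap M) ≠ 0 := by
  have := congr_arg LinearMap.det (linMap_linMap M N)
  rw [h, linMap_one, LinearMap.det_comp, LinearMap.det_id] at this
  exact left_ne_zero_of_mul_eq_one this

theorem setIntegral_region_eq {M N : Matrix (Fin 2) (Fin 2) ℝ} {c : Plane} (hNM : N * M = 1)
    {S T : Triangle} (h : ∀ v, affMap M c (S.points v) = T.points v) (f : Plane → ℝ) :
    ∫ x in region T, f x = |LinearMap.det (linMap M)| * ∫ x in region S, f (affMap M c x) := by
  have hd : ∀ x ∈ region S, HasFDerivWithinAt (affMap M c) (linMap M).toContinuousLinearMap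
      (region S) x := fun x _ => by
    have := ((linMap M).toContinuousLinearMap.hasFDerivWithinAt (s := region S) (x := x)).const_add c
    exact this
  have hinj : Set.InjOn (affMap M c) (region S) :=
    (Function.LeftInverse.injective (affMap_inverse' hNM c)).injOn
  rw [region_eq_image h, integral_image_eq_integral_abs_det_fderiv_smul volume
    (isCompact_region S).measurableSet hd hinj, ← integral_const_mul]
  simp [ContinuousLinearMap.det]

theorem pull_pull {M N : Matrix (Fin 2) (Fin 2) ℝ} {c : Plane} (h : M * N = 1) (p : Poly) :
    pull N (-linMap N c) (pull M c p) = p := by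
  refine sub_eq_zero.1 (eq_zero_of_val fun x => ?_)
  rw [val_sub, val_pull, val_pull, affMap_inverse h, sub_self]

/-! ### Rigid motions -/

theorem mem_rigidMotions {r : Fin 2 → Poly} : r ∈ rigidMotions ↔ ∃ a b w : ℝ,
    r 0 = MvPolynomial.C a - MvPolynomial.C w * MvPolynomial.X 1 ∧
    r 1 = MvPolynomial.C b + MvPolynomial.C w * MvPolynomial.X 0 := by
  rw [rigidMotions, Submodule.mem_span_triple]
  refine exists_congr fun a => exists_congr fun b => exists_congr fun w => ?_
  rw [eq_comm, funext_iff, Fin.forall_fin_two]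
  simp [MvPolynomial.smul_eq_C_mul, sub_eq_add_neg]

/-- The transformation `q ↦ N (q ∘ F)` of vector fields, with `F x = c + M x`. -/
def pullVec (N M : Matrix (Fin 2) (Fin 2) ℝ) (c : Plane) : (Fin 2 → Poly) →ₗ[ℝ] (Fin 2 → Poly) where
  toFun q i := ∑ a, N i a • pull M c (q a)
  map_add' p q := by ext1 i; simp [Finset.sum_add_distrib]
  map_smul' t q := by ext1 i; simp [smul_comm t]

/-- The transformation `σ ↦ N (σ ∘ F) Nᵀ` of matrix fields, with `F x = c + M x`. -/
def pullMat (N M : Matrix (Fin 2) (Fin 2) ℝ) (c : Plane) :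
    Matrix (Fin 2) (Fin 2) Poly →ₗ[ℝ] Matrix (Fin 2) (Fin 2) Poly where
  toFun σ := Matrix.of fun i j => ∑ a, ∑ b, (N i a * N j b) • pull M c (σ a b)
  map_add' p q := by ext1 i j; simp [Finset.sum_add_distrib]
  map_smul' t q := by
    ext1 i j
    simp only [Matrix.of_apply, Matrix.smul_apply, map_smul, smul_comm _ t, Finset.smul_sum,
      RingHom.id_apply]

theorem pullVec_apply (N M : Matrix (Fin 2) (Fin 2) ℝ) (c : Plane) (q : Fin 2 → Poly) (i : Fin 2) :
    pullVec N M c q i = ∑ a, N i a • pull M c (q a) := rfl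

theorem pullMat_apply (N M : Matrix (Fin 2) (Fin 2) ℝ) (c : Plane)
    (σ : Matrix (Fin 2) (Fin 2) Poly) (i j : Fin 2) :
    pullMat N M c σ i j = ∑ a, ∑ b, (N i a * N j b) • pull M c (σ a b) := rfl

/-- The chain rule produces a factor `M` that cancels against the second factor `N`, leaving only
the `N` that acts on rows. This cancellation is why matrix fields are transformed on both sides. -/
theorem div_pullMat {N M : Matrix (Fin 2) (Fin 2) ℝ} (h : M * N = 1) (c : Plane)
    (σ : Matrix (Fin 2) (Fin 2) Poly) :
    div (pullMat N M c σ) = pullVec N M c (div σ) := by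
  ext1 i
  have e : ∀ a b, MvPolynomial.C (M a 0) * MvPolynomial.C (N 0 b) +
      MvPolynomial.C (M a 1) * MvPolynomial.C (N 1 b) =
      (MvPolynomial.C ((1 : Matrix (Fin 2) (Fin 2) ℝ) a b) : Poly) := fun a b => by
    rw [← h, Matrix.mul_apply, Fin.sum_univ_two]
    simp
  have e00 := e 0 0
  have e01 := e 0 1
  have e10 := e 1 0
  have e11 := e 1 1
  simp only [Matrix.one_apply_eq, Matrix.one_apply_ne, ne_eq, zero_ne_one, one_ne_zero,
    not_false_eq_true, map_one, map_zero] at e00 e01 e10 e11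
  simp only [div_apply, pullVec_apply, pullMat_apply, Fin.sum_univ_two, map_add, map_smul,
    partialD_pull]
  simp only [MvPolynomial.smul_eq_C_mul, map_mul]
  set x := fun l a b => pull M c (partialD l (σ a b))
  linear_combination
    MvPolynomial.C (N i 0) * (x 0 0 0 * e00 + x 1 0 0 * e10 + x 0 0 1 * e01 + x 1 0 1 * e11) +
    MvPolynomial.C (N i 1) * (x 0 1 0 * e00 + x 1 1 0 * e10 + x 0 1 1 * e01 + x 1 1 1 * e11)

theorem pullVec_pullVec {N M : Matrix (Fin 2) (Fin 2) ℝ} (h : M * N = 1) (c : Plane)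
    (q : Fin 2 → Poly) : pullVec M N (-linMap N c) (pullVec N M c q) = q := by
  ext1 i
  have e : ∀ i b, M i 0 * N 0 b + M i 1 * N 1 b = (1 : Matrix (Fin 2) (Fin 2) ℝ) i b := by
    intro i b
    rw [← h, Matrix.mul_apply, Fin.sum_univ_two]
  simp only [pullVec_apply, Fin.sum_univ_two, map_add, map_smul, pull_pull h]
  trans (M i 0 * N 0 0 + M i 1 * N 1 0) • q 0 + (M i 0 * N 0 1 + M i 1 * N 1 1) • q 1
  · module
  · rw [e, e]
    fin_cases i <;> simp [Matrix.one_apply]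

theorem pullVec_mem_bubbleQ (N : Matrix (Fin 2) (Fin 2) ℝ) {M : Matrix (Fin 2) (Fin 2) ℝ}
    {c : Plane} {S T : Triangle}
    (h : ∀ v, affMap M c (S.points v) = T.points v) {d : ℕ} {q : Fin 2 → Poly}
    (hq : q ∈ bubbleQ T d) : pullVec N M c q ∈ bubbleQ S d := by
  intro i
  rw [pullVec_apply]
  refine ⟨Submodule.sum_mem _ fun a _ => ?_, VanishesAtVertices.sum fun a _ => ?_⟩
  · exact Submodule.smul_mem _ _ (pull_mem_polyDeg M c (hq a).1)
  · exact ((hq a).2.pull h).smul _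

theorem pullMat_mem_bubbleSigma (N : Matrix (Fin 2) (Fin 2) ℝ) {M : Matrix (Fin 2) (Fin 2) ℝ}
    {c : Plane} {S T : Triangle}
    (h : ∀ v, affMap M c (S.points v) = T.points v) {d : ℕ} {σ : Matrix (Fin 2) (Fin 2) Poly}
    (hσ : σ ∈ bubbleSigma T d) : pullMat N M c σ ∈ bubbleSigma S d := by
  refine ⟨Matrix.IsSymm.ext fun i j => ?_, fun i j => ⟨?_, ?_, fun e => ?_⟩⟩
  · rw [pullMat_apply, pullMat_apply, Finset.sum_comm]
    simp only [hσ.1.apply, mul_comm]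
  · rw [pullMat_apply]
    exact Submodule.sum_mem _ fun a _ => Submodule.sum_mem _ fun b _ =>
      Submodule.smul_mem _ _ (pull_mem_polyDeg M c (hσ.2 a b).1)
  · rw [pullMat_apply]
    exact VanishesAtVertices.sum fun a _ => VanishesAtVertices.sum fun b _ =>
      ((hσ.2 a b).2.1.pull h).smul _
  · rw [← mem_edgeVanishing, pullMat_apply]
    exact Submodule.sum_mem _ fun a _ => Submodule.sum_mem _ fun b _ =>
      Submodule.smul_mem _ _ (pull_mem_edgeVanishing h ((hσ.2 a b).2.2 e))

/-- Change of variables moves the transformation onto the test field, which becomes `Nᵀ (r ∘ F⁻¹)`.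
This is again a rigid motion, since `Nᵀ W N` is skew when `W` is. -/
theorem pullVec_mem_rmPerp {N M : Matrix (Fin 2) (Fin 2) ℝ} {c : Plane} {S T : Triangle}
    (hNM : N * M = 1) (h : ∀ v, affMap M c (S.points v) = T.points v) {q : Fin 2 → Poly}
    (hq : q ∈ rmPerp T) : pullVec N M c q ∈ rmPerp S := by
  intro r hr
  have hr' : (fun a => ∑ i, N i a • pull N (-linMap N c) (r i)) ∈ rigidMotions := by
    obtain ⟨α, β, w, h0, h1⟩ := mem_rigidMotions.1 hr
    generalize -linMap N c = c'
    -- In dimension two a skew matrix `W` satisfies `Nᵀ W N = det N • W`, which gives the new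
    -- rotation coefficient.
    refine mem_rigidMotions.2 ⟨N 0 0 * (α - w * c' 1) + N 1 0 * (β + w * c' 0),
      N 0 1 * (α - w * c' 1) + N 1 1 * (β + w * c' 0), w * (N 0 0 * N 1 1 - N 1 0 * N 0 1), ?_, ?_⟩
    all_goals
      simp only [h0, h1, Fin.sum_univ_two, map_add, map_sub, map_mul, pull_C, pull_X,
        MvPolynomial.smul_eq_C_mul]
      ring
  have := hq _ hr'
  rw [setIntegral_region_eq hNM h] at this
  have hdet := abs_ne_zero.2 (det_linMap_ne_zero (mul_eq_one_comm.1 hNM))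
  rw [← (mul_eq_zero.1 this).resolve_left hdet]
  congr 1
  ext1 x
  simp only [pullVec_apply, val_add, val_smul, val_pull, affMap_inverse' hNM, Fin.sum_univ_two]
  ring

/-! ### The reference triangle -/

theorem refTriangle_independent :
    AffineIndependent ℝ ![(0 : Plane), !₂[(1 : ℝ), 0], !₂[(0 : ℝ), 1]] := by
  rw [affineIndependent_iff_of_fintype]
  intro w hw h
  rw [Finset.weightedVSub_eq_linear_combination _ hw, Fin.sum_univ_three] at h
  have h0 := congr_arg (fun x : Plane => x 0) h
  have h1 := congr_arg (fun x : Plane => x 1) h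
  simp at h0 h1
  rw [Fin.sum_univ_three, h0, h1] at hw
  intro i
  fin_cases i
  · simpa using hw
  · exact h0
  · exact h1

/-- The triangle with vertices `(0, 0)`, `(1, 0)`, `(0, 1)`. -/
def refTriangle : Triangle := ⟨_, refTriangle_independent⟩

theorem refTriangle_zero : refTriangle.points 0 = 0 := rfl

theorem refTriangle_one : refTriangle.points 1 = !₂[(1 : ℝ), 0] := rfl

theorem refTriangle_two : refTriangle.points 2 = !₂[(0 : ℝ), 1] := rfl

/-- The matrix of the linear part of the affine map from the reference triangle to `T`. -/
def refMatrix (T : Triangle) : Matrix (Fin 2) (Fin 2) ℝ :=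
  Matrix.of fun i j => ![T.points 1 i - T.points 0 i, T.points 2 i - T.points 0 i] j

theorem affMap_refMatrix (T : Triangle) (v : Fin 3) :
    affMap (refMatrix T) (T.points 0) (refTriangle.points v) = T.points v := by
  ext i
  rw [affMap_apply, Fin.sum_univ_two]
  fin_cases v
  · simp [refTriangle_zero]
  · simp [refTriangle_one, refMatrix]
  · simp [refTriangle_two, refMatrix]

theorem det_refMatrix_ne_zero (T : Triangle) : (refMatrix T).det ≠ 0 := by
  intro hdet
  have key : ∀ s t : ℝ, s • (T.points 1 - T.points 0) + t • (T.points 2 - T.points 0) = 0 →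
      s = 0 ∧ t = 0 := by
    intro s t h
    have hw : ∑ i, ![-s - t, s, t] i = 0 := by simp [Fin.sum_univ_three]; ring
    have := (affineIndependent_iff_of_fintype ℝ T.points).1 T.independent ![-s - t, s, t] hw (by
      rw [Finset.weightedVSub_eq_linear_combination _ hw, Fin.sum_univ_three, ← h]
      simp
      module)
    exact ⟨this 1, this 2⟩
  set a := T.points 1 - T.points 0 with ha
  set b := T.points 2 - T.points 0 with hb
  have hd : a 0 * b 1 = a 1 * b 0 := by
    rw [Matrix.det_fin_two] at hdet
    simp [refMatrix] at hdet
    simp [ha, hb]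
    linarith
  -- If the determinant vanishes, both `b 0 • a - a 0 • b` and `b 1 • a - a 1 • b` are zero.
  -- Independence then forces `b = 0`, which contradicts independence once more.
  have h0 := key (b 0) (-a 0) (by
    ext i
    fin_cases i <;> simp <;> linarith)
  have h1 := key (b 1) (-a 1) (by
    ext i
    fin_cases i <;> simp <;> linarith)
  have := key 0 1 (by
    ext i
    fin_cases i <;> simp [h0.1, h1.1])
  exact one_ne_zero this.2

theorem refMatrix_mul_inv (T : Triangle) : refMatrix T * (refMatrix T)⁻¹ = 1 :=
  Matrix.mul_nonsing_inv _ (isUnit_iff_ne_zero.2 (det_refMatrix_ne_zero T))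

theorem refMatrix_inv_mul (T : Triangle) : (refMatrix T)⁻¹ * refMatrix T = 1 :=
  Matrix.nonsing_inv_mul _ (isUnit_iff_ne_zero.2 (det_refMatrix_ne_zero T))

theorem affMap_refMatrix_inv (T : Triangle) (v : Fin 3) :
    affMap (refMatrix T)⁻¹ (-linMap (refMatrix T)⁻¹ (T.points 0)) (T.points v) =
      refTriangle.points v := by
  rw [← affMap_refMatrix T v, affMap_inverse' (refMatrix_inv_mul T)]

theorem region_refTriangle :
    region refTriangle = {x : Plane | 0 ≤ x 0 ∧ 0 ≤ x 1 ∧ x 0 + x 1 ≤ 1} := by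
  apply Set.Subset.antisymm
  · refine convexHull_min ?_ ?_
    · rintro _ ⟨v, rfl⟩
      fin_cases v
      · simp [refTriangle_zero]
      · simp [refTriangle_one]
      · simp [refTriangle_two]
    · rintro x ⟨hx0, hx1, hx2⟩ y ⟨hy0, hy1, hy2⟩ a b ha hb hab
      simp only [Set.mem_ofPred_eq, PiLp.add_apply, PiLp.smul_apply, smul_eq_mul]
      refine ⟨by positivity, by positivity, ?_⟩
      nlinarith [mul_le_mul_of_nonneg_left hx2 ha, mul_le_mul_of_nonneg_left hy2 hb]
  · rintro x ⟨hx0, hx1, hx2⟩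
    have := (convex_convexHull ℝ (Set.range refTriangle.points)).sum_mem (t := Finset.univ)
      (w := ![1 - x 0 - x 1, x 0, x 1]) (z := refTriangle.points) ?_ ?_
      (fun i _ => subset_convexHull ℝ _ ⟨i, rfl⟩)
    · suffices h : x = ∑ i, ![1 - x 0 - x 1, x 0, x 1] i • refTriangle.points i from
        Set.mem_of_eq_of_mem h this
      ext i
      fin_cases i <;>
        simp [Fin.sum_univ_three, refTriangle_zero, refTriangle_one, refTriangle_two]
    · intro i _
      fin_cases i
      · simp; linarith
      · exact hx0
      · exact hx1
    · simp [Fin.sum_univ_three]; ring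

theorem mem_edge_refTriangle_zero {a : ℝ} (ha : a ∈ Set.Icc (0 : ℝ) 1) :
    !₂[a, 1 - a] ∈ edge refTriangle 0 := by
  rw [edge_eq]
  refine ⟨1 - a, ⟨by linarith [ha.2], by linarith [ha.1]⟩, ?_⟩
  ext i
  fin_cases i <;> simp [edgeVec, refTriangle_one, refTriangle_two]

theorem mem_edge_refTriangle_one {a : ℝ} (ha : a ∈ Set.Icc (0 : ℝ) 1) :
    !₂[0, a] ∈ edge refTriangle 1 := by
  rw [edge_eq]
  refine ⟨1 - a, ⟨by linarith [ha.2], by linarith [ha.1]⟩, ?_⟩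
  ext i
  fin_cases i <;> simp [edgeVec, refTriangle_zero, refTriangle_two]

theorem mem_edge_refTriangle_two {a : ℝ} (ha : a ∈ Set.Icc (0 : ℝ) 1) :
    !₂[a, 0] ∈ edge refTriangle 2 := by
  rw [edge_eq]
  refine ⟨a, ha, ?_⟩
  ext i
  fin_cases i <;> simp [edgeVec, refTriangle_zero, refTriangle_one]

/-! ### Integration on the reference triangle -/

theorem hasDerivAt_val_line (p : Poly) (x d : Plane) (s : ℝ) :
    HasDerivAt (fun s : ℝ => val p (x + s • d)) (val (dirD d p) (x + s • d)) s := by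
  have := (lineRes x d p).hasDerivAt s
  rw [derivative_lineRes, eval_lineRes] at this
  simpa only [eval_lineRes] using this

theorem integral_indicator_line {A : Set Plane} (p : Poly) (x d : Plane) {a b : ℝ} (hab : a ≤ b)
    (h : ∀ s, x + s • d ∈ A ↔ s ∈ Set.Icc a b) (ha : val p (x + a • d) = 0)
    (hb : val p (x + b • d) = 0) :
    ∫ s : ℝ, A.indicator (val (dirD d p)) (x + s • d) = 0 := by
  have : ∀ s : ℝ, A.indicator (val (dirD d p)) (x + s • d) =
      (Set.Icc a b).indicator (fun s => val (dirD d p) (x + s • d)) s := fun s => by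
    simp only [Set.indicator, h]
  simp only [this]
  rw [integral_indicator measurableSet_Icc, integral_Icc_eq_integral_Ioc,
    ← intervalIntegral.integral_of_le hab,
    intervalIntegral.integral_eq_sub_of_hasDerivAt (fun s _ => hasDerivAt_val_line p x d s), ha, hb,
    sub_zero]
  exact ((continuous_val _).comp (by fun_prop)).intervalIntegrable _ _

/-- Fubini along the coordinate direction: each slice is a chord with endpoints on edges, so the
fundamental theorem of calculus gives zero there. -/
theorem integral_region_refTriangle_partialD {p : Poly}
    (hp : ∀ e, p ∈ edgeVanishing refTriangle e) (i : Fin 2) :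
    ∫ x in region refTriangle, val (partialD i p) x = 0 := by
  have hmp : MeasurePreserving (fun z : ℝ × ℝ => (!₂[z.1, z.2] : Plane)) volume volume := by
    have := (PiLp.volume_preserving_toLp (Fin 2)).comp (volume_preserving_finTwoArrow ℝ).symm
    exact this
  have hemb : MeasurableEmbedding (fun z : ℝ × ℝ => (!₂[z.1, z.2] : Plane)) :=
    ((MeasurableEquiv.finTwoArrow (α := ℝ)).symm.trans
      (MeasurableEquiv.toLp 2 (Fin 2 → ℝ))).measurableEmbedding
  have hm := (isCompact_region refTriangle).measurableSet
  rw [← integral_indicator hm, ← hmp.integral_comp hemb]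
  have hint : Integrable ((region refTriangle).indicator (val (partialD i p))) :=
    ((continuous_val _).continuousOn.integrableOn_compact (isCompact_region _)).integrable_indicator
      hm
  have hint' : Integrable fun z : ℝ × ℝ =>
      (region refTriangle).indicator (val (partialD i p)) !₂[z.1, z.2] := (hmp.integrable_comp_emb hemb).2 hint
  rw [region_refTriangle] at *
  have hd : ∀ i, dirD (EuclideanSpace.single i 1) p = partialD i p := fun i => by
    rw [dirD_apply]
    fin_cases i <;> simp
  have hv : ∀ e x, x ∈ edge refTriangle e → val p x = 0 := fun e x => hp e x
  set A := {x : Plane | 0 ≤ x 0 ∧ 0 ≤ x 1 ∧ x 0 + x 1 ≤ 1} with hA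
  fin_cases i
  · rw [Measure.volume_eq_prod, integral_prod_symm _ hint']
    have : ∀ b : ℝ, ∫ a : ℝ, A.indicator (val (partialD 0 p)) !₂[a, b] = 0 := by
      intro b
      by_cases hb : b ∈ Set.Icc (0 : ℝ) 1
      · rw [← hd 0, ← integral_indicator_line (A := A) p !₂[0, b] (EuclideanSpace.single 0 1)
          (a := 0) (b := 1 - b) (by linarith [hb.2]) ?_ ?_ ?_]
        · congr 1
          ext1 s
          congr 1
          ext i
          fin_cases i <;> simp
        · intro s
          simp only [hA, Set.mem_ofPred_eq, Set.mem_Icc]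
          simp
          exact fun _ => ⟨fun h => by linarith [h.2], fun h => ⟨hb.1, by linarith⟩⟩
        · simpa using hv _ _ (mem_edge_refTriangle_one hb)
        · convert! hv _ _ (mem_edge_refTriangle_zero (a := 1 - b)
            ⟨by linarith [hb.2], by linarith [hb.1]⟩) using 2
          ext i
          fin_cases i <;> simp
      · rw [← integral_zero ℝ ℝ]
        congr 1
        ext1 a
        refine Set.indicator_of_notMem (fun h => hb ?_) _
        simp [hA] at h
        exact ⟨h.2.1, by linarith [h.1, h.2.2]⟩
    exact (congr_arg _ (funext this)).trans (integral_zero _ _)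
  · rw [Measure.volume_eq_prod, integral_prod _ hint']
    have : ∀ a : ℝ, ∫ b : ℝ, A.indicator (val (partialD 1 p)) !₂[a, b] = 0 := by
      intro a
      by_cases ha : a ∈ Set.Icc (0 : ℝ) 1
      · rw [← hd 1, ← integral_indicator_line (A := A) p !₂[a, 0] (EuclideanSpace.single 1 1)
          (a := 0) (b := 1 - a) (by linarith [ha.2]) ?_ ?_ ?_]
        · congr 1
          ext1 s
          congr 1
          ext i
          fin_cases i <;> simp
        · intro s
          simp only [hA, Set.mem_ofPred_eq, Set.mem_Icc]
          simp
          exact ⟨fun h => ⟨h.2.1, by linarith [h.2.2]⟩, fun h => ⟨ha.1, h.1, by linarith [h.2]⟩⟩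
        · simpa using hv _ _ (mem_edge_refTriangle_two ha)
        · convert! hv _ _ (mem_edge_refTriangle_zero ha) using 2
          ext i
          fin_cases i <;> simp
      · rw [← integral_zero ℝ ℝ]
        congr 1
        ext1 b
        refine Set.indicator_of_notMem (fun h => ha ?_) _
        simp [hA] at h
        exact ⟨h.1, by linarith [h.2.1, h.2.2]⟩
    exact (congr_arg _ (funext this)).trans (integral_zero _ _)

/-- A nonnegative function of zero integral vanishes almost everywhere, by continuity everywhere in
the open triangle, and a polynomial vanishing on a product of infinite sets is zero. -/
theorem eq_zero_of_integral_refTriangle_eq_zero {p : Poly}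
    (h : ∀ x ∈ region refTriangle, 0 ≤ val p x) (h' : ∫ x in region refTriangle, val p x = 0) :
    p = 0 := by
  rw [setIntegral_eq_zero_iff_of_nonneg_ae
    (ae_restrict_of_forall_mem (isCompact_region _).measurableSet h)
    ((continuous_val _).continuousOn.integrableOn_compact (isCompact_region _))] at h'
  set U : Set Plane := {x | 0 < x 0 ∧ 0 < x 1 ∧ x 0 + x 1 < 1} with hU
  have hUo : IsOpen U := by
    rw [hU]
    exact (isOpen_lt (f := fun _ : Plane => (0 : ℝ)) (g := fun x : Plane => x 0)
      (by fun_prop) (by fun_prop)).inter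
      ((isOpen_lt (f := fun _ : Plane => (0 : ℝ)) (g := fun x : Plane => x 1)
        (by fun_prop) (by fun_prop)).inter
      (isOpen_lt (f := fun x : Plane => x 0 + x 1) (g := fun _ : Plane => (1 : ℝ))
        (by fun_prop) (by fun_prop)))
  have hsub : U ⊆ region refTriangle := by
    rw [region_refTriangle]
    exact fun x hx => ⟨hx.1.le, hx.2.1.le, hx.2.2.le⟩
  have heq := Measure.eqOn_open_of_ae_eq (ae_restrict_of_ae_restrict_of_subset hsub h') hUo
    (continuous_val p).continuousOn continuousOn_const
  -- The square `(0, 1/2)²` lies inside the open triangle.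
  refine MvPolynomial.funext_set (fun _ => Set.Ioo (0 : ℝ) (1 / 2))
    (fun _ => Set.Ioo_infinite (by norm_num)) fun x hx => ?_
  have h0 := hx 0 (Set.mem_univ _)
  have h1 := hx 1 (Set.mem_univ _)
  have := heq (x := WithLp.toLp 2 x) ⟨h0.1, h1.1, by linarith [h0.2, h1.2]⟩
  simpa [val] using this

/-- Integration by parts: `div (σ r) = div σ · r + σ : ∇r`. The last term is zero, since `σ` is
symmetric and `∇r` is skew, and `σ r` vanishes on the boundary. -/
theorem div_mem_rmPerp_refTriangle {k : ℕ} {σ : Matrix (Fin 2) (Fin 2) Poly}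
    (hσ : σ ∈ bubbleSigma refTriangle k) : div σ ∈ rmPerp refTriangle := by
  intro r hr
  obtain ⟨a, b, w, h0, h1⟩ := mem_rigidMotions.1 hr
  have h10 : σ 1 0 = σ 0 1 := hσ.1.apply 0 1
  have hmul : ∀ (j : Fin 2) e, r 0 * σ 0 j + r 1 * σ 1 j ∈ edgeVanishing refTriangle e := by
    intro j e x hx
    simp [val_add, val_mul, (hσ.2 0 j).2.2 e x hx, (hσ.2 1 j).2.2 e x hx]
  have e0 := integral_region_refTriangle_partialD (hmul 0) 0
  have e1 := integral_region_refTriangle_partialD (hmul 1) 1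
  have hi : ∀ p, IntegrableOn (val p) (region refTriangle) := fun p =>
    (continuous_val p).continuousOn.integrableOn_compact (isCompact_region _)
  have := integral_add (hi (partialD 0 (r 0 * σ 0 0 + r 1 * σ 1 0)))
    (hi (partialD 1 (r 0 * σ 0 1 + r 1 * σ 1 1)))
  rw [e0, e1, add_zero] at this
  rw [← this]
  congr 1
  ext1 x
  rw [← val_add]
  simp only [Fin.sum_univ_two, ← val_mul, ← val_add, div_apply, map_add, partialD_mul, h0, h1,
    map_sub, partialD_C, partialD_X, h10]
  congr 1
  simp
  ring

/-! ### Barycentric coordinates on the reference triangle -/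

/-- The barycentric coordinates of the reference triangle. -/
def bary : Fin 3 → Poly :=
  ![1 - MvPolynomial.X 0 - MvPolynomial.X 1, MvPolynomial.X 0, MvPolynomial.X 1]

theorem val_bary (i j : Fin 3) : val (bary i) (refTriangle.points j) = if i = j then 1 else 0 := by
  fin_cases i <;> fin_cases j <;>
    simp [bary, refTriangle_zero, refTriangle_one, refTriangle_two, val_sub, val_one, val_X]

theorem bary_mem_polyDeg (i : Fin 3) : bary i ∈ polyDeg 1 := by
  fin_cases i
  · exact sub_mem (sub_mem (by simp [mem_polyDeg]) (X_mem_polyDeg 0)) (X_mem_polyDeg 1)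
  · exact X_mem_polyDeg 0
  · exact X_mem_polyDeg 1

/-- The constant partial derivatives of the barycentric coordinates. -/
def baryGrad (i : Fin 3) (j : Fin 2) : ℝ := ![![-1, -1], ![1, 0], ![0, 1]] i j

theorem partialD_bary (i : Fin 3) (j : Fin 2) :
    partialD j (bary i) = MvPolynomial.C (baryGrad i j) := by
  fin_cases i <;> fin_cases j <;> simp [bary, baryGrad, partialD_X, partialD_one]

theorem bary_mem_edgeVanishing (e : Fin 3) : bary e ∈ edgeVanishing refTriangle e := by
  rw [mem_edgeVanishing_iff_lineRes]
  fin_cases e <;>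
    simp [bary, lineRes, edgeVec, refTriangle_zero, refTriangle_one, refTriangle_two]

/-- Write the point as the barycentric combination of the vertices and eliminate the coordinate of
vertex `e + 1`; the terms without `bary e` parametrize the edge by `bary (e + 2)`. -/
theorem bary_dvd_X_sub (e : Fin 3) (i : Fin 2) : bary e ∣ MvPolynomial.X i -
    (MvPolynomial.C (refTriangle.points (e + 1) i) +
      MvPolynomial.C (edgeVec refTriangle e i) * bary (e + 2)) := by
  refine ⟨MvPolynomial.C (refTriangle.points e i - refTriangle.points (e + 1) i), ?_⟩
  fin_cases e <;> fin_cases i <;>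
    simp [bary, edgeVec, refTriangle_zero, refTriangle_one, refTriangle_two] <;> ring

/-- The map `φ` restricts to the edge line and substitutes `bary (e + 2)` for the line parameter. It
is the identity modulo `bary e`, and it annihilates whatever vanishes on the edge. -/
theorem bary_dvd_iff {e : Fin 3} {p : Poly} : bary e ∣ p ↔ p ∈ edgeVanishing refTriangle e := by
  constructor
  · rintro ⟨w, rfl⟩ x hx
    rw [val_mul, bary_mem_edgeVanishing e x hx, zero_mul]
  · intro hp
    set φ : Poly →ₐ[ℝ] Poly := (Polynomial.aeval (bary (e + 2))).comp
      (lineRes (refTriangle.points (e + 1)) (edgeVec refTriangle e)) with hφ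
    have key : ∀ p, bary e ∣ p - φ p := by
      intro p
      induction p using MvPolynomial.induction_on with
      | C a => simp [hφ, lineRes]
      | add p q hp hq =>
        rw [map_add, add_sub_add_comm]
        exact dvd_add hp hq
      | mul_X p i hp =>
        have hX : φ (MvPolynomial.X i) = MvPolynomial.C (refTriangle.points (e + 1) i) +
            MvPolynomial.C (edgeVec refTriangle e i) * bary (e + 2) := by
          simp [hφ, lineRes]
        have h := bary_dvd_X_sub e i
        rw [← hX] at h
        have : p * MvPolynomial.X i - φ (p * MvPolynomial.X i) =
            (p - φ p) * MvPolynomial.X i +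
              φ p * (MvPolynomial.X i - φ (MvPolynomial.X i)) := by
          rw [map_mul]
          ring
        rw [this]
        exact dvd_add (hp.mul_right _) (h.mul_left _)
    have h0 : φ p = 0 := by
      rw [hφ, AlgHom.comp_apply, mem_edgeVanishing_iff_lineRes.1 hp, map_zero]
    simpa [h0] using key p

/-- The multiples of `bary e` form the kernel of restriction to a line, a homomorphism into the
domain of one-variable polynomials. -/
theorem bary_prime (e : Fin 3) : Prime (bary e) := by
  have hne : bary e ≠ 0 := fun h => by
    simpa [h, val_zero] using val_bary e e
  refine ⟨hne, fun h => ?_, fun p q h => ?_⟩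
  · have h1 := bary_dvd_iff.1 (h.dvd (a := 1)) _ (points_succ_mem_edge _ e)
    simp [val_one] at h1
  · simp only [bary_dvd_iff, mem_edgeVanishing_iff_lineRes, map_mul, mul_eq_zero] at h ⊢
    exact h

theorem bary_not_dvd {i j : Fin 3} (h : i ≠ j) (n : ℕ) : ¬bary i ∣ bary j ^ n := by
  rintro ⟨w, hw⟩
  have := congr_arg (fun p => val p (refTriangle.points j)) hw
  simp [val_pow, val_mul, val_bary, h] at this

/-- The cubic bubble. -/
def bub : Poly := bary 0 * bary 1 * bary 2

theorem bub_mem_polyDeg : bub ∈ polyDeg 3 :=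
  mul_mem_polyDeg (mul_mem_polyDeg (bary_mem_polyDeg 0) (bary_mem_polyDeg 1)) (bary_mem_polyDeg 2)

theorem bub_ne_zero : bub ≠ 0 :=
  mul_ne_zero (mul_ne_zero (bary_prime 0).ne_zero (bary_prime 1).ne_zero) (bary_prime 2).ne_zero

theorem bub_nonneg {x : Plane} (hx : x ∈ region refTriangle) : 0 ≤ val bub x := by
  rw [region_refTriangle] at hx
  obtain ⟨h0, h1, h2⟩ := hx
  simp only [bub, bary, val_mul, val_sub, val_one, val_X, Matrix.cons_val]
  have : 0 ≤ 1 - x 0 - x 1 := by linarith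
  positivity

theorem bary_dvd_bub (e : Fin 3) : bary e ∣ bub := by
  fin_cases e
  · exact Dvd.intro (bary 1 * bary 2) (by simp [bub, mul_assoc])
  · exact Dvd.intro (bary 0 * bary 2) (by simp [bub]; ring)
  · exact Dvd.intro_left _ rfl

theorem bub_mul_mem_edgeVanishing (p : Poly) (e : Fin 3) :
    bub * p ∈ edgeVanishing refTriangle e :=
  bary_dvd_iff.1 ((bary_dvd_bub e).mul_right p)

theorem bub_vanishesAtVertices : VanishesAtVertices refTriangle 1 bub := by
  rw [vanishesAtVertices_succ_iff]
  refine ⟨fun v => ?_, fun i => vanishesAtVertices_zero_iff.2 fun v => ?_⟩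
  · fin_cases v <;> simp [bub, val_mul, val_bary]
  · fin_cases v <;> simp [bub, partialD_mul, val_add, val_mul, val_bary]

/-- The polynomial vanishes to order `n` at the vertices. -/
def HasVertexOrder (T : Triangle) : ℕ → Poly → Prop
  | 0, _ => True
  | n + 1, p => VanishesAtVertices T n p

theorem hasVertexOrder_succ_iff {T : Triangle} {n : ℕ} {p : Poly} :
    HasVertexOrder T (n + 1) p ↔ (∀ v, val p (T.points v) = 0) ∧
      ∀ i, HasVertexOrder T n (partialD i p) := by
  cases n with
  | zero => simp [HasVertexOrder, vanishesAtVertices_zero_iff]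
  | succ n => exact vanishesAtVertices_succ_iff

theorem HasVertexOrder.add {T : Triangle} {n : ℕ} {p q : Poly} (hp : HasVertexOrder T n p)
    (hq : HasVertexOrder T n q) : HasVertexOrder T n (p + q) := by
  cases n with
  | zero => trivial
  | succ n => exact VanishesAtVertices.add hp hq

theorem HasVertexOrder.pred {T : Triangle} {n : ℕ} {p : Poly} (hp : HasVertexOrder T (n + 1) p) :
    HasVertexOrder T n p := by
  cases n with
  | zero => trivial
  | succ n => exact VanishesAtVertices.mono (Nat.le_succ n) hp

/-- Vanishing orders add, by the Leibniz rule and induction on the total order. -/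
theorem HasVertexOrder.mul {T : Triangle} {m n : ℕ} {p q : Poly} (hp : HasVertexOrder T m p)
    (hq : HasVertexOrder T n q) : HasVertexOrder T (m + n) (p * q) := by
  obtain ⟨s, hs⟩ : ∃ s, m + n = s := ⟨_, rfl⟩
  induction s generalizing m n p q with
  | zero => rw [hs]; trivial
  | succ s ih =>
    rw [hs, hasVertexOrder_succ_iff]
    refine ⟨fun v => ?_, fun i => ?_⟩
    · rw [val_mul]
      cases m with
      | zero =>
        obtain rfl : n = s + 1 := by omega
        rw [(hasVertexOrder_succ_iff.1 hq).1, mul_zero]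
      | succ m => rw [(hasVertexOrder_succ_iff.1 hp).1, zero_mul]
    · rw [partialD_mul]
      refine HasVertexOrder.add ?_ ?_
      · cases m with
        | zero =>
          obtain rfl : n = s + 1 := by omega
          have := ih (m := 0) (p := partialD i p) trivial hq.pred (by omega)
          rwa [zero_add] at this
        | succ m =>
          have := ih ((hasVertexOrder_succ_iff.1 hp).2 i) hq (by omega)
          rwa [show m + n = s by omega] at this
      · cases n with
        | zero =>
          obtain rfl : m = s + 1 := by omega
          exact ih (n := 0) (q := partialD i q) hp.pred trivial (by omega)
        | succ n =>
          have := ih hp ((hasVertexOrder_succ_iff.1 hq).2 i) (by omega)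
          rwa [show m + n = s by omega] at this

theorem bub_mul_vanishesAtVertices (p : Poly) : VanishesAtVertices refTriangle 1 (bub * p) :=
  HasVertexOrder.mul (m := 2) (n := 0) bub_vanishesAtVertices trivial

theorem bub_mul_vanishesAtVertices_two {p : Poly}
    (hp : ∀ v, val p (refTriangle.points v) = 0) : VanishesAtVertices refTriangle 2 (bub * p) :=
  HasVertexOrder.mul (m := 2) (n := 1) bub_vanishesAtVertices (vanishesAtVertices_zero_iff.2 hp)

/-! ### Dimension counts -/

theorem finrank_polyDeg (d : ℕ) : 2 * Module.finrank ℝ (polyDeg d) = (d + 1) * (d + 2) := by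
  -- Exponents are encoded by their total degree and their first entry.
  have e : {s : Fin 2 →₀ ℕ | (s.sum fun _ e => e) ≤ d} ≃
      (Finset.range (d + 1)).sigma fun n => Finset.range (n + 1) :=
    { toFun := fun s => ⟨⟨s.1 0 + s.1 1, s.1 0⟩, by
        have := s.2
        simp [Finsupp.sum_fintype] at this ⊢
        omega⟩
      invFun := fun t => ⟨Finsupp.equivFunOnFinite.symm ![t.1.2, t.1.1 - t.1.2], by
        have := Finset.mem_sigma.1 t.2
        simp only [Finset.mem_range] at this
        simp [Finsupp.sum_fintype]
        omega⟩
      left_inv := fun s => by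
        ext i
        fin_cases i <;> simp
      right_inv := fun t => by
        obtain ⟨⟨n, a⟩, ht⟩ := t
        simp only [Finset.mem_sigma, Finset.mem_range] at ht
        have : a + (n - a) = n := by omega
        simp [this] }
  have h : Module.finrank ℝ (polyDeg d) = ∑ n ∈ Finset.range (d + 1), (n + 1) := by
    rw [polyDeg, MvPolynomial.restrictTotalDegree, Module.finrank_eq_nat_card_basis
      (MvPolynomial.basisRestrictSupport ℝ _), Nat.card_congr e,
      Nat.card_eq_fintype_card, Fintype.card_coe, Finset.card_sigma]
    simp
  rw [h]
  clear h e
  induction d with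
  | zero => simp
  | succ d ih =>
    rw [Finset.sum_range_succ, mul_add, ih]
    ring

/-! ### Upper bound for the space of scalar bubbles. -/

theorem bary_totalDegree (e : Fin 3) : 1 ≤ (bary e).totalDegree := by
  by_contra! h
  have h1 := MvPolynomial.totalDegree_eq_zero_iff_eq_C.1 (Nat.lt_one_iff.1 h)
  have h2 := val_bary e e
  have h3 := val_bary e (e + 1)
  rw [h1, val_C] at h2 h3
  rw [h2] at h3
  simp at h3

/-- Factors are extracted one at a time: differentiating `ℓ w` or, twice, `ℓ² w` across the edge
leaves modulo `ℓ = bary e` a nonzero constant multiple of `w`, so `ℓ` divides `w` again. -/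
theorem bary_pow_dvd {e : Fin 3} {u : Poly} (h0 : u ∈ edgeVanishing refTriangle e)
    (h1 : ∀ i, partialD i u ∈ edgeVanishing refTriangle e)
    (h2 : ∀ i j, partialD i (partialD j u) ∈ edgeVanishing refTriangle e) :
    bary e ^ 3 ∣ u := by
  obtain ⟨i, hi⟩ : ∃ i, baryGrad e i ≠ 0 := by
    fin_cases e
    · exact ⟨0, by simp [baryGrad]⟩
    · exact ⟨0, by simp [baryGrad]⟩
    · exact ⟨1, by simp [baryGrad]⟩
  have hu : ∀ c : ℝ, c ≠ 0 → ∀ w z, MvPolynomial.C c * w + bary e * z ∈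
      edgeVanishing refTriangle e → bary e ∣ w := by
    intro c hc w z h
    rw [← bary_dvd_iff] at h
    have h' := (dvd_add_left (Dvd.intro z rfl)).1 h
    have : w = MvPolynomial.C c⁻¹ * (MvPolynomial.C c * w) := by
      rw [← mul_assoc, ← MvPolynomial.C_mul, inv_mul_cancel₀ hc, MvPolynomial.C_1, one_mul]
    rw [this]
    exact h'.mul_left _
  obtain ⟨w, rfl⟩ := bary_dvd_iff.2 h0
  have e1 := h1 i
  rw [partialD_mul, partialD_bary] at e1
  obtain ⟨w, rfl⟩ := hu _ hi _ _ e1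
  have e2 := h2 i i
  simp only [partialD_mul, partialD_bary, map_add, partialD_C] at e2
  -- The three terms of the second derivative of `ℓ² w`, with `c = ∂ᵢℓ`: `2c² w + ℓ (4c ∂ᵢw + ℓ
  -- ∂ᵢ∂ᵢw)`.
  obtain ⟨z, rfl⟩ := hu (2 * baryGrad e i ^ 2) (by positivity) w
    (4 * MvPolynomial.C (baryGrad e i) * partialD i w + bary e * partialD i (partialD i w)) (by
      convert! e2 using 1
      simp only [MvPolynomial.C_mul, MvPolynomial.C_pow, map_ofNat]
      ring)
  exact ⟨z, by ring⟩

/-- The cubes of the three barycentric coordinates each divide `u`, and these coordinates are primes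
that do not divide one another. -/
theorem bub_pow_dvd {d : ℕ} {u : Poly} (hu : u ∈ bubbleU refTriangle d) : bub ^ 3 ∣ u := by
  have hE : ∀ i j e, partialD i (partialD j u) ∈ edgeVanishing refTriangle e := fun i j e =>
    partialD_partialD_mem_edgeVanishing (fun x hx => (hu.2.2 e x hx).1)
      (fun x hx => (hu.2.2 e x hx).2.1) (fun x hx => (hu.2.2 e x hx).2.2) i j
  have hF : ∀ i e, partialD i u ∈ edgeVanishing refTriangle e := fun i =>
    mem_edgeVanishing_of_dirD_mem (fun e => add_mem (Submodule.smul_mem _ _ (hE 0 i e))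
      (Submodule.smul_mem _ _ (hE 1 i e))) ((hu.2.1.partialD i).val_eq_zero 0)
  have h : ∀ e, bary e ^ 3 ∣ u := fun e =>
    bary_pow_dvd (fun x hx => (hu.2.2 e x hx).1) (fun i => hF i e)
      (fun i j => hE i j e)
  obtain ⟨w, rfl⟩ := h 0
  obtain ⟨w, rfl⟩ := (bary_prime 1).pow_dvd_of_dvd_mul_left 3
    (bary_not_dvd (by decide) 3) (h 1)
  have h2 := h 2
  rw [← mul_assoc, ← mul_pow] at h2
  obtain ⟨w, rfl⟩ := (bary_prime 2).pow_dvd_of_dvd_mul_left 3 (by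
    rw [mul_pow]
    intro h
    rcases (bary_prime 2).dvd_or_dvd h with h | h
    · exact bary_not_dvd (by decide) 3 h
    · exact bary_not_dvd (by decide) 3 h) h2
  exact ⟨w, by rw [bub]; ring⟩

theorem bub_pow_totalDegree : 9 ≤ (bub ^ 3).totalDegree := by
  have hb : 3 ≤ bub.totalDegree := by
    rw [bub, MvPolynomial.totalDegree_mul_of_isDomain
      (mul_ne_zero (bary_prime 0).ne_zero (bary_prime 1).ne_zero) (bary_prime 2).ne_zero,
      MvPolynomial.totalDegree_mul_of_isDomain (bary_prime 0).ne_zero (bary_prime 1).ne_zero]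
    have := bary_totalDegree 0
    have := bary_totalDegree 1
    have := bary_totalDegree 2
    omega
  have h := bub_ne_zero
  rw [pow_succ, pow_two, MvPolynomial.totalDegree_mul_of_isDomain (mul_ne_zero h h) h,
    MvPolynomial.totalDegree_mul_of_isDomain h h]
  omega

/-- The cofactor of `bub ^ 3` has degree at most `j + 7 - 9 = j - 2`; for `j < 2` there is no room
for a nonzero one. Doubling and moving `j` to the left avoid division and truncated subtraction. -/
theorem finrank_bubbleU (j : ℕ) :
    2 * Module.finrank ℝ (bubbleU refTriangle (j + 7)) + j ≤ j ^ 2 := by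
  have key : ∀ u ∈ bubbleU refTriangle (j + 7), u = 0 ∨ ∃ w, u = bub ^ 3 * w ∧
      9 + w.totalDegree ≤ j + 7 := by
    intro u hu
    obtain ⟨w, rfl⟩ := bub_pow_dvd hu
    by_cases hw : w = 0
    · exact Or.inl (by rw [hw, mul_zero])
    · refine Or.inr ⟨w, rfl, ?_⟩
      have := mem_polyDeg.1 hu.1
      rw [MvPolynomial.totalDegree_mul_of_isDomain (pow_ne_zero 3 bub_ne_zero) hw] at this
      have := bub_pow_totalDegree
      omega
  rcases lt_or_ge j 2 with hj | hj
  · have : bubbleU refTriangle (j + 7) = ⊥ := by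
      refine (Submodule.eq_bot_iff _).2 fun u hu => ?_
      rcases key u hu with h | ⟨w, -, h⟩
      · exact h
      · omega
    rw [this, finrank_bot]
    interval_cases j <;> simp
  · obtain ⟨n, rfl⟩ := Nat.exists_eq_add_of_le hj
    have hle : bubbleU refTriangle (2 + n + 7) ≤
        (polyDeg n).map (LinearMap.mulLeft ℝ (bub ^ 3)) := by
      intro u hu
      rcases key u hu with rfl | ⟨w, rfl, h⟩
      · exact zero_mem _
      · exact ⟨w, mem_polyDeg.2 (by omega), rfl⟩
    have h1 := Submodule.finrank_mono hle
    have h2 := Submodule.finrank_map_le (LinearMap.mulLeft ℝ (bub ^ 3)) (polyDeg n)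
    have h3 := finrank_polyDeg n
    nlinarith

theorem finiteDimensional_of_forall_polyDeg {ι : Type*} [Finite ι] {d : ℕ}
    {V : Submodule ℝ (ι → Poly)} (h : ∀ v ∈ V, ∀ i, v i ∈ polyDeg d) : FiniteDimensional ℝ V := by
  let f : V →ₗ[ℝ] (ι → polyDeg d) := LinearMap.pi fun i =>
    ((LinearMap.proj i ∘ₗ V.subtype).codRestrict (polyDeg d) fun v => h v v.2 i)
  refine FiniteDimensional.of_injective f fun v w hvw => ?_
  ext1
  funext i
  exact congr_arg Subtype.val (congr_fun hvw i)

instance finiteDimensional_bubbleQ (T : Triangle) (d : ℕ) : FiniteDimensional ℝ (bubbleQ T d) :=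
  finiteDimensional_of_forall_polyDeg fun _ hv i => (hv i).1

instance finiteDimensional_bubbleSigma (T : Triangle) (k : ℕ) :
    FiniteDimensional ℝ (bubbleSigma T k) := by
  let f : bubbleSigma T k →ₗ[ℝ] (Fin 2 → Fin 2 → polyDeg k) := LinearMap.pi fun i =>
    LinearMap.pi fun j =>
    (Matrix.entryLinearMap ℝ Poly i j ∘ₗ (bubbleSigma T k).subtype).codRestrict (polyDeg k)
      fun v => (v.2.2 i j).1
  refine FiniteDimensional.of_injective f fun v w hvw => ?_
  ext i j : 2
  exact congr_arg Subtype.val (congr_fun₂ hvw i j)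

/-- The symmetric matrix with entries `τ 0`, `τ 1`, `τ 2`, multiplied by the cubic bubble. -/
def bubMatrix : (Fin 3 → Poly) →ₗ[ℝ] Matrix (Fin 2) (Fin 2) Poly where
  toFun τ := Matrix.of fun i j => bub * τ (![![0, 1], ![1, 2]] i j)
  map_add' τ τ' := by ext1 i j; simp [mul_add]
  map_smul' c τ := by ext1 i j; simp

theorem bubMatrix_apply (τ : Fin 3 → Poly) (i j : Fin 2) :
    bubMatrix τ i j = bub * τ (![![0, 1], ![1, 2]] i j) := rfl

theorem bubMatrix_injective : Function.Injective bubMatrix := by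
  intro τ τ' h
  have h' : ∀ i j, τ (![![0, 1], ![1, 2]] i j) = τ' (![![0, 1], ![1, 2]] i j) := fun i j =>
    mul_left_cancel₀ bub_ne_zero (congr_fun₂ h i j)
  ext1 l
  fin_cases l
  exacts [h' 0 0, h' 0 1, h' 1 1]

theorem bubMatrix_mem_bubbleSigma {m : ℕ} {τ : Fin 3 → Poly} (hτ : ∀ l, τ l ∈ polyDeg m)
    (hτ' : ∀ l v, val (τ l) (refTriangle.points v) = 0) :
    bubMatrix τ ∈ bubbleSigma refTriangle (m + 3) := by
  refine ⟨Matrix.IsSymm.ext fun i j => ?_, fun i j => ?_⟩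
  · fin_cases i <;> fin_cases j <;> rfl
  · rw [bubMatrix_apply]
    generalize (![![0, 1], ![1, 2]] i j : Fin 3) = l
    exact ⟨add_comm 3 m ▸ mul_mem_polyDeg bub_mem_polyDeg (hτ l),
      bub_mul_vanishesAtVertices_two (hτ' l), bub_mul_mem_edgeVanishing _⟩

/-- The cubic bubble already vanishes on the edges and to order two at the vertices. Only the vertex
values of its three cofactors have to be killed, which is at most nine conditions. -/
theorem finrank_bubbleSigma (m : ℕ) :
    3 * Module.finrank ℝ (polyDeg m) ≤
      Module.finrank ℝ (bubbleSigma refTriangle (m + 3)) + 9 := by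
  let φ : (Fin 3 → polyDeg m) →ₗ[ℝ] (Fin 3 × Fin 3 → ℝ) :=
    { toFun := fun τ z => val (τ z.1) (refTriangle.points z.2)
      map_add' := fun τ τ' => by ext z; simp [val_add]
      map_smul' := fun c τ => by ext z; simp [val_smul] }
  have hφ := φ.finrank_range_add_finrank_ker
  have hr := Submodule.finrank_le (LinearMap.range φ)
  rw [Module.finrank_pi_fintype] at hφ
  simp only [Module.finrank_fintype_fun_eq_card, Fintype.card_prod, Fintype.card_fin,
    Finset.sum_const, Finset.card_univ, smul_eq_mul] at hφ hr
  let g : (Fin 3 → polyDeg m) →ₗ[ℝ] Matrix (Fin 2) (Fin 2) Poly :=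
    bubMatrix ∘ₗ LinearMap.pi fun i => (polyDeg m).subtype ∘ₗ LinearMap.proj i
  have hg : Function.Injective g := fun τ τ' h =>
    funext fun l => Subtype.ext (congr_fun (bubMatrix_injective h) l)
  have hle : (LinearMap.ker φ).map g ≤ bubbleSigma refTriangle (m + 3) := by
    rintro _ ⟨τ, hτ, rfl⟩
    exact bubMatrix_mem_bubbleSigma (fun l => (τ l).2) fun l v => congr_fun hτ (l, v)
  have h1 := (Submodule.equivMapOfInjective g hg (LinearMap.ker φ)).finrank_eq
  have h2 := Submodule.finrank_mono hle
  omega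

/-- The cubic with value `t 0` and gradient `(t 1, t 2)` at the vertex `v` and with vanishing
value and gradient at the other vertices. -/
def hermite (v : Fin 3) (t : Fin 3 → ℝ) : Poly :=
  MvPolynomial.C (t 0) * (bary v ^ 2 * (MvPolynomial.C 3 - MvPolynomial.C 2 * bary v)) +
  bary v ^ 2 * (MvPolynomial.C (t 1) * (MvPolynomial.X 0 -
    MvPolynomial.C (refTriangle.points v 0)) + MvPolynomial.C (t 2) * (MvPolynomial.X 1 -
    MvPolynomial.C (refTriangle.points v 1)))

theorem hermite_mem_polyDeg (v : Fin 3) (t : Fin 3 → ℝ) : hermite v t ∈ polyDeg 3 := by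
  have h1 := bary_mem_polyDeg v
  have h2 := pow_mem_polyDeg h1 2
  have hC : ∀ c (p : Poly) d, p ∈ polyDeg d → MvPolynomial.C c * p ∈ polyDeg d := fun c p d hp => by
    simpa using mul_mem_polyDeg (C_mem_polyDeg 0 c) hp
  refine add_mem (hC _ _ _ (mul_mem_polyDeg h2 (sub_mem (C_mem_polyDeg _ _) (hC _ _ _ h1))))
    (mul_mem_polyDeg h2 (add_mem (hC _ _ _ (sub_mem (X_mem_polyDeg _) (C_mem_polyDeg _ _)))
      (hC _ _ _ (sub_mem (X_mem_polyDeg _) (C_mem_polyDeg _ _)))))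

theorem val_hermite (v w : Fin 3) (t : Fin 3 → ℝ) :
    val (hermite v t) (refTriangle.points w) = if v = w then t 0 else 0 := by
  simp only [hermite, val_add, val_mul, val_sub, val_pow, val_C, val_X, val_bary]
  split_ifs with h
  · subst h; ring
  · ring

theorem val_partialD_hermite (i : Fin 2) (v w : Fin 3) (t : Fin 3 → ℝ) :
    val (partialD i (hermite v t)) (refTriangle.points w) = if v = w then t i.succ else 0 := by
  simp only [hermite, map_add, map_sub, partialD_mul, pow_two, partialD_C, partialD_bary,
    partialD_X, val_add, val_mul, val_sub, val_C, val_X, val_bary, val_zero]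
  split_ifs with h h1 h2 h2 h1 h2 h2 <;> fin_cases i <;> simp [val_one, val_zero] at * <;>
    (subst h; ring)

theorem finrank_le_two_mul {E : Type*} [AddCommGroup E] [Module ℝ E] {V : Submodule ℝ (Fin 2 → E)}
    {H : Submodule ℝ E} [FiniteDimensional ℝ H] (h : ∀ v ∈ V, ∀ i, v i ∈ H) :
    Module.finrank ℝ V ≤ 2 * Module.finrank ℝ H := by
  let ψ : V →ₗ[ℝ] (Fin 2 → H) :=
    LinearMap.pi fun i => (LinearMap.proj i ∘ₗ V.subtype).codRestrict H fun q => h q q.2 i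
  have hψ : Function.Injective ψ := by
    intro q q' hq
    ext i : 2
    exact congr_arg Subtype.val (congr_fun hq i)
  have := LinearMap.finrank_le_finrank_of_injective hψ
  rw [Module.finrank_pi_fintype] at this
  simpa using this

theorem finrank_le_finrank_map_add {V W : Type*} [AddCommGroup V] [Module ℝ V] [AddCommGroup W]
    [Module ℝ W] (f : V →ₗ[ℝ] W) (p q : Submodule ℝ V) [FiniteDimensional ℝ p]
    [FiniteDimensional ℝ q] (h : ∀ x ∈ p, f x = 0 → x ∈ q) :
    Module.finrank ℝ p ≤ Module.finrank ℝ (p.map f) + Module.finrank ℝ q := by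
  have h1 := (f.domRestrict p).finrank_range_add_finrank_ker
  rw [LinearMap.range_domRestrict] at h1
  have h2 := (Submodule.equivMapOfInjective _ p.injective_subtype
    (LinearMap.ker (f.domRestrict p))).finrank_eq
  have h3 : (LinearMap.ker (f.domRestrict p)).map p.subtype ≤ q := by
    rintro _ ⟨x, hx, rfl⟩
    exact h x x.2 hx
  have h4 := Submodule.finrank_mono h3
  omega

/-- Hermite cubics show that the nine functionals of vertex values and gradients are independent in
degree at least three, so each of the two components loses nine dimensions. -/
theorem finrank_bubbleQ (m : ℕ) :
    Module.finrank ℝ (bubbleQ refTriangle (m + 3)) + 18 ≤ 2 * Module.finrank ℝ (polyDeg (m + 3)) := by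
  let φ : polyDeg (m + 3) →ₗ[ℝ] (Fin 3 × Fin 3 → ℝ) :=
    { toFun := fun p z => val ((![LinearMap.id, partialD 0, partialD 1] z.2 : Module.End ℝ Poly) p)
        (refTriangle.points z.1)
      map_add' := fun τ τ' => by ext z; simp [val_add]
      map_smul' := fun c τ => by ext z; simp [val_smul] }
  have hsurj : LinearMap.range φ = ⊤ := by
    refine LinearMap.range_eq_top.2 fun t => ⟨⟨∑ v, hermite v fun i => t (v, i),
      sum_mem fun v _ => polyDeg_mono (by omega) (hermite_mem_polyDeg v _)⟩, ?_⟩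
    ext ⟨w, i⟩
    fin_cases i
    · simp [φ, val_sum, val_hermite]
    · simp [φ, val_sum, val_partialD_hermite]
    · simp [φ, val_sum, val_partialD_hermite]
  have hφ := φ.finrank_range_add_finrank_ker
  rw [hsurj, finrank_top] at hφ
  simp only [Module.finrank_fintype_fun_eq_card, Fintype.card_prod, Fintype.card_fin] at hφ
  have hH := (Submodule.equivMapOfInjective _ (polyDeg (m + 3)).injective_subtype
    (LinearMap.ker φ)).finrank_eq
  have hfin : FiniteDimensional ℝ ((LinearMap.ker φ).map (polyDeg (m + 3)).subtype) :=
    Submodule.finiteDimensional_of_le (S₂ := polyDeg (m + 3)) (Submodule.map_subtype_le _ _)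
  have := finrank_le_two_mul (V := bubbleQ refTriangle (m + 3))
    (H := (LinearMap.ker φ).map (polyDeg (m + 3)).subtype) fun q hq i => by
    have h := (hq i).2
    refine ⟨⟨q i, (hq i).1⟩, ?_, rfl⟩
    ext ⟨w, l⟩
    fin_cases l
    · exact h.val_eq_zero w
    · exact (h.partialD 0).val_eq_zero w
    · exact (h.partialD 1).val_eq_zero w
  omega

/-- The fields `bub • r`, with `r` in the given family of rigid motions, are bubbles. None but zero
is orthogonal to the rigid motions, because testing with `r` itself gives the integral of `bub
|r|²`. -/
theorem finrank_bubbleQ_inf_rmPerp {n m : ℕ} (ρ : (Fin n → ℝ) →ₗ[ℝ] (Fin 2 → Poly))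
    (hinj : Function.Injective ρ) (hrm : ∀ t, ρ t ∈ rigidMotions)
    (hdeg : ∀ t i, ρ t i ∈ polyDeg m) :
    Module.finrank ℝ ↥(bubbleQ refTriangle (m + 3) ⊓ rmPerp refTriangle) + n ≤
      Module.finrank ℝ (bubbleQ refTriangle (m + 3)) := by
  let μ : (Fin 2 → Poly) →ₗ[ℝ] (Fin 2 → Poly) :=
    LinearMap.pi fun i => LinearMap.mulLeft ℝ bub ∘ₗ LinearMap.proj i
  have hμ : ∀ r i, μ r i = bub * r i := fun r i => rfl
  have hμinj : Function.Injective (μ ∘ₗ ρ) := by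
    intro s t h
    refine hinj (funext fun i => mul_left_cancel₀ bub_ne_zero ?_)
    exact congr_fun h i
  have hle : LinearMap.range (μ ∘ₗ ρ) ≤ bubbleQ refTriangle (m + 3) := by
    rintro _ ⟨t, rfl⟩ i
    exact ⟨add_comm 3 m ▸ mul_mem_polyDeg bub_mem_polyDeg (hdeg t i),
      bub_mul_vanishesAtVertices _⟩
  have hdisj : Disjoint (bubbleQ refTriangle (m + 3) ⊓ rmPerp refTriangle)
      (LinearMap.range (μ ∘ₗ ρ)) := by
    rw [Submodule.disjoint_def]
    rintro _ ⟨-, h⟩ ⟨t, rfl⟩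
    have h1 := h _ (hrm t)
    have h2 : ∀ x, ∑ i, val ((μ ∘ₗ ρ) t i) x * val (ρ t i) x =
        val (bub * (ρ t 0 ^ 2 + ρ t 1 ^ 2)) x := fun x => by
      simp only [LinearMap.comp_apply, hμ, Fin.sum_univ_two, val_mul, val_add, val_pow]
      ring
    simp only [h2] at h1
    have h3 := eq_zero_of_integral_refTriangle_eq_zero (fun x hx => by
      rw [val_mul, val_add, val_pow, val_pow]
      have := bub_nonneg hx
      positivity) h1
    have h4 := (mul_eq_zero.1 h3).resolve_left bub_ne_zero
    have h5 : ∀ x, val (ρ t 0) x ^ 2 + val (ρ t 1) x ^ 2 = 0 := fun x => by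
      simpa [val_add, val_pow, val_zero] using congr_arg (fun p => val p x) h4
    have h6 : ρ t = 0 := by
      ext1 i
      refine eq_zero_of_val fun x => ?_
      have h7 := h5 x
      revert i
      rw [Fin.forall_fin_two]
      constructor <;> refine pow_eq_zero_iff two_ne_zero |>.1 ?_ <;>
        linarith [sq_nonneg (val (ρ t 0) x), sq_nonneg (val (ρ t 1) x)]
    rw [LinearMap.comp_apply, h6, map_zero]
  have h1 := Submodule.finrank_sup_add_finrank_inf_eq
    (bubbleQ refTriangle (m + 3) ⊓ rmPerp refTriangle) (LinearMap.range (μ ∘ₗ ρ))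
  have h2 := Submodule.finrank_mono (sup_le (inf_le_left : bubbleQ refTriangle (m + 3) ⊓
    rmPerp refTriangle ≤ _) hle)
  rw [hdisj.eq_bot, finrank_bot, LinearMap.finrank_range_of_inj hμinj] at h1
  simp at h1
  omega

theorem finrank_bubbleQ_inf_rmPerp_of_le (m : ℕ) :
    Module.finrank ℝ ↥(bubbleQ refTriangle (m + 4) ⊓ rmPerp refTriangle) + 3 ≤
      Module.finrank ℝ (bubbleQ refTriangle (m + 4)) := by
  let ρ : (Fin 3 → ℝ) →ₗ[ℝ] (Fin 2 → Poly) :=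
    { toFun := fun t => ![MvPolynomial.C (t 0) - MvPolynomial.C (t 2) * MvPolynomial.X 1,
        MvPolynomial.C (t 1) + MvPolynomial.C (t 2) * MvPolynomial.X 0]
      map_add' := fun s t => by
        ext1 i
        fin_cases i <;> simp <;> ring
      map_smul' := fun s t => by
        ext1 i
        fin_cases i <;> simp [MvPolynomial.smul_eq_C_mul] <;> ring }
  have hC : ∀ (c : ℝ) (i : Fin 2), MvPolynomial.C c * MvPolynomial.X i ∈ polyDeg (m + 1) :=
    fun c i => polyDeg_mono (by omega) (mul_mem_polyDeg (C_mem_polyDeg 0 c) (X_mem_polyDeg i))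
  refine finrank_bubbleQ_inf_rmPerp (m := m + 1) ρ ?_ ?_ ?_
  · rw [injective_iff_map_eq_zero]
    intro t ht
    have h0 : MvPolynomial.C (t 0) - MvPolynomial.C (t 2) * MvPolynomial.X 1 = (0 : Poly) :=
      congr_fun ht 0
    have h1 : MvPolynomial.C (t 1) + MvPolynomial.C (t 2) * MvPolynomial.X 0 = (0 : Poly) :=
      congr_fun ht 1
    have a0 := congr_arg (fun p => val p 0) h0
    have a1 := congr_arg (fun p => val p 0) h1
    have a2 := congr_arg (fun p => val p !₂[(1 : ℝ), 0]) h1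
    simp [val_sub, val_add, val_mul, val_C, val_X, val_zero] at a0 a1 a2
    ext i
    fin_cases i
    · exact a0
    · exact a1
    · simpa [a1] using a2
  · exact fun t => mem_rigidMotions.2 ⟨t 0, t 1, t 2, rfl, rfl⟩
  · intro t i
    fin_cases i
    · exact sub_mem (C_mem_polyDeg _ _) (hC _ _)
    · exact add_mem (C_mem_polyDeg _ _) (hC _ _)

/-- Cubic bubbles form a space of dimension at most `2 · 10 - 18 = 2`, and the constant rigid
motions already remove two dimensions. Rotations are left out because `bub` times a rotation has
degree four. -/
theorem bubbleQ_three_inf_rmPerp : bubbleQ refTriangle 3 ⊓ rmPerp refTriangle = ⊥ := by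
  let ρ : (Fin 2 → ℝ) →ₗ[ℝ] (Fin 2 → Poly) :=
    { toFun := fun t i => MvPolynomial.C (t i)
      map_add' := fun s t => by ext1 i; simp
      map_smul' := fun s t => by ext1 i; simp [MvPolynomial.smul_eq_C_mul] }
  have h : Module.finrank ℝ ↥(bubbleQ refTriangle 3 ⊓ rmPerp refTriangle) + 2 ≤
      Module.finrank ℝ (bubbleQ refTriangle 3) := finrank_bubbleQ_inf_rmPerp (m := 0) ρ ?_ ?_ ?_
  · have h1 : Module.finrank ℝ (bubbleQ refTriangle 3) + 18 ≤
        2 * Module.finrank ℝ (polyDeg 3) := finrank_bubbleQ 0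
    have h2 := finrank_polyDeg 3
    rw [← Submodule.finrank_eq_zero (R := ℝ)]
    omega
  · intro s t hst
    ext i
    exact MvPolynomial.C_injective _ _ (congr_fun hst i)
  · exact fun t => mem_rigidMotions.2 ⟨t 0, t 1, 0, by simp [ρ], by simp [ρ]⟩
  · exact fun t i => C_mem_polyDeg _ _

/-! ### Surjectivity of the divergence on the reference triangle. -/

theorem div_mem_bubbleQ {T : Triangle} {k : ℕ} {σ : Matrix (Fin 2) (Fin 2) Poly}
    (hσ : σ ∈ bubbleSigma T k) : div σ ∈ bubbleQ T (k - 1) := by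
  intro i
  rw [div_apply]
  exact ⟨Submodule.sum_mem _ fun j _ => partialD_mem_polyDeg (hσ.2 i j).1 j,
    VanishesAtVertices.sum fun j _ => (hσ.2 i j).2.1.partialD j⟩

theorem map_div_refTriangle (j : ℕ) :
    (bubbleSigma refTriangle (j + 5)).map div =
      bubbleQ refTriangle (j + 4) ⊓ rmPerp refTriangle := by
  refine Submodule.eq_of_le_of_finrank_le ?_ ?_
  · rintro _ ⟨σ, hσ, rfl⟩
    have h := div_mem_bubbleQ hσ
    rw [show j + 5 - 1 = j + 4 from rfl] at h
    exact ⟨h, div_mem_rmPerp_refTriangle hσ⟩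
  have hfin : FiniteDimensional ℝ (bubbleU refTriangle (j + 7)) :=
    Submodule.finiteDimensional_of_le (S₂ := polyDeg (j + 7)) fun u hu => hu.1
  have hker : ∀ σ ∈ bubbleSigma refTriangle (j + 5), div σ = 0 →
      σ ∈ (bubbleU refTriangle (j + 7)).map airy := fun σ hσ h => exists_airy_eq hσ h
  have h1 : Module.finrank ℝ ↥(bubbleSigma refTriangle (j + 5)) ≤
      Module.finrank ℝ ↥((bubbleSigma refTriangle (j + 5)).map div) +
        Module.finrank ℝ ↥((bubbleU refTriangle (j + 7)).map airy) :=
    finrank_le_finrank_map_add div _ _ hker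
  have h3 := Submodule.finrank_map_le airy (bubbleU refTriangle (j + 7))
  have h5 := finrank_bubbleU j
  have h6 : 3 * Module.finrank ℝ (polyDeg (j + 2)) ≤
    Module.finrank ℝ (bubbleSigma refTriangle (j + 5)) + 9 := finrank_bubbleSigma (j + 2)
  have h7 := finrank_polyDeg (j + 2)
  have h8 : Module.finrank ℝ (bubbleQ refTriangle (j + 4)) + 18 ≤
    2 * Module.finrank ℝ (polyDeg (j + 4)) := finrank_bubbleQ (j + 1)
  have h9 := finrank_polyDeg (j + 4)
  have h10 := finrank_bubbleQ_inf_rmPerp_of_le j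
  -- The bounds match exactly: `3(j+3)(j+4)/2 - 9 - j(j-1)/2 = (j+5)(j+6) - 21`.
  nlinarith

theorem exists_div_eq_refTriangle (k : ℕ) {q : Fin 2 → Poly}
    (hq : q ∈ bubbleQ refTriangle (k - 1) ⊓ rmPerp refTriangle) :
    ∃ σ ∈ bubbleSigma refTriangle k, div σ = q := by
  -- For `k ≤ 4` the target sits inside the trivial space of degree three; from `k = 5` on the count
  -- applies.
  rcases le_or_gt k 4 with hk | hk
  · have : q ∈ bubbleQ refTriangle 3 ⊓ rmPerp refTriangle :=
      ⟨fun i => ⟨polyDeg_mono (by omega) (hq.1 i).1, (hq.1 i).2⟩, hq.2⟩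
    rw [bubbleQ_three_inf_rmPerp, Submodule.mem_bot] at this
    exact ⟨0, zero_mem _, by rw [map_zero, this]⟩
  · obtain ⟨j, rfl⟩ : ∃ j, k = j + 5 := ⟨k - 5, by omega⟩
    rw [show j + 5 - 1 = j + 4 from rfl, ← map_div_refTriangle j] at hq
    exact hq

/-! ### Exactness on a general triangle -/

theorem div_mem_rmPerp {T : Triangle} {k : ℕ} {σ : Matrix (Fin 2) (Fin 2) Poly}
    (hσ : σ ∈ bubbleSigma T k) : div σ ∈ rmPerp T := by
  have h := div_mem_rmPerp_refTriangle
    (pullMat_mem_bubbleSigma (refMatrix T)⁻¹ (affMap_refMatrix T) hσ)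
  rw [div_pullMat (refMatrix_mul_inv T)] at h
  rw [← pullVec_pullVec (refMatrix_mul_inv T) (T.points 0) (div σ)]
  exact pullVec_mem_rmPerp (refMatrix_mul_inv T) (affMap_refMatrix_inv T) h

theorem pullVec_mem_inf {T : Triangle} {d : ℕ} {q : Fin 2 → Poly}
    (hq : q ∈ bubbleQ T d ⊓ rmPerp T) :
    pullVec (refMatrix T)⁻¹ (refMatrix T) (T.points 0) q ∈
      bubbleQ refTriangle d ⊓ rmPerp refTriangle :=
  ⟨pullVec_mem_bubbleQ _ (affMap_refMatrix T) hq.1,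
    pullVec_mem_rmPerp (refMatrix_inv_mul T) (affMap_refMatrix T) hq.2⟩

/-- The transformation of matrix fields on the reference triangle to matrix fields on `T`. -/
def pushMat (T : Triangle) : Matrix (Fin 2) (Fin 2) Poly →ₗ[ℝ] Matrix (Fin 2) (Fin 2) Poly :=
  pullMat (refMatrix T) (refMatrix T)⁻¹ (-linMap (refMatrix T)⁻¹ (T.points 0))

theorem pushMat_mem {T : Triangle} {k : ℕ} {σ : Matrix (Fin 2) (Fin 2) Poly}
    (hσ : σ ∈ bubbleSigma refTriangle k) : pushMat T σ ∈ bubbleSigma T k :=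
  pullMat_mem_bubbleSigma _ (affMap_refMatrix_inv T) hσ

theorem div_pushMat {T : Triangle} {q : Fin 2 → Poly} {σ : Matrix (Fin 2) (Fin 2) Poly}
    (h : div σ = pullVec (refMatrix T)⁻¹ (refMatrix T) (T.points 0) q) :
    div (pushMat T σ) = q := by
  rw [pushMat, div_pullMat (refMatrix_inv_mul T), h, pullVec_pullVec (refMatrix_mul_inv T)]

theorem exists_div_eq {T : Triangle} {k : ℕ} {q : Fin 2 → Poly}
    (hq : q ∈ bubbleQ T (k - 1) ⊓ rmPerp T) : ∃ σ ∈ bubbleSigma T k, div σ = q := by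
  obtain ⟨σ, hσ, h⟩ := exists_div_eq_refTriangle k (pullVec_mem_inf hq)
  exact ⟨pushMat T σ, pushMat_mem hσ, div_pushMat h⟩

/-! ### Norm estimates -/

theorem exists_forall_le_mul_inner {V : Type*} [NormedAddCommGroup V] [InnerProductSpace ℝ V]
    [FiniteDimensional ℝ V] (A : V →ₗ[ℝ] V →ₗ[ℝ] ℝ) :
    ∃ C, 0 ≤ C ∧ ∀ x, A x x ≤ C * inner ℝ x x := by
  refine ⟨‖A.toContinuousBilinearMap‖, ContinuousLinearMap.opNorm_nonneg _, fun x => ?_⟩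
  rw [real_inner_self_eq_norm_sq, pow_two, ← mul_assoc]
  exact (le_abs_self _).trans (A.toContinuousBilinearMap.le_opNorm₂ x x)

/-- Taking `B` as the inner product turns the claim into boundedness of a bilinear form on a
finite-dimensional space. -/
theorem exists_forall_le_mul {V : Type*} [AddCommGroup V] [Module ℝ V] [FiniteDimensional ℝ V]
    (A B : V →ₗ[ℝ] V →ₗ[ℝ] ℝ) (hsymm : ∀ x y, B x y = B y x) (hnonneg : ∀ x, 0 ≤ B x x)
    (hdef : ∀ x, B x x = 0 → x = 0) : ∃ C, 0 ≤ C ∧ ∀ x, A x x ≤ C * B x x := by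
  let core : InnerProductSpace.Core ℝ V :=
    { inner := fun x y => B x y
      conj_inner_symm := fun x y => hsymm y x
      re_inner_nonneg := hnonneg
      add_left := fun x y z => by simp
      smul_left := fun x y r => by simp
      definite := hdef }
  exact @exists_forall_le_mul_inner V core.toNormedAddCommGroup (.ofCore core.toCore) _ A

/-- The integral over the triangle as a linear form on polynomials. -/
def intLin (T : Triangle) : Poly →ₗ[ℝ] ℝ where
  toFun p := ∫ x in region T, val p x
  map_add' p q := by
    have hi : ∀ p, IntegrableOn (val p) (region T) := fun p =>
      (continuous_val p).continuousOn.integrableOn_compact (isCompact_region _)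
    simp only [val_add]
    exact integral_add (hi p) (hi q)
  map_smul' c p := by
    simp only [val_smul]
    exact integral_const_mul _ _

theorem intLin_apply (T : Triangle) (p : Poly) : intLin T p = ∫ x in region T, val p x := rfl

theorem intLin_le {T : Triangle} {p q : Poly} {K : ℝ} (h : ∀ x, val p x ≤ K * val q x) :
    intLin T p ≤ K * intLin T q := by
  have hi : ∀ p, IntegrableOn (val p) (region T) := fun p =>
    (continuous_val p).continuousOn.integrableOn_compact (isCompact_region _)
  rw [← smul_eq_mul, ← map_smul]
  exact setIntegral_mono (hi p) (hi _) fun x => by rw [val_smul]; exact h x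

theorem intLin_nonneg {T : Triangle} {p : Poly} (h : ∀ x, 0 ≤ val p x) : 0 ≤ intLin T p :=
  integral_nonneg h

theorem intLin_eq (T : Triangle) (p : Poly) :
    intLin T p = |LinearMap.det (linMap (refMatrix T))| *
      intLin refTriangle (pull (refMatrix T) (T.points 0) p) := by
  simp only [intLin_apply, val_pull]
  exact setIntegral_region_eq (refMatrix_inv_mul T) (affMap_refMatrix T) _

/-- The `L²` form on the reference triangle of a finite family of polynomials that depend
linearly on a vector. -/
def l2Form {V ι : Type*} [AddCommGroup V] [Module ℝ V] [Fintype ι] (L : ι → V →ₗ[ℝ] Poly) :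
    V →ₗ[ℝ] V →ₗ[ℝ] ℝ :=
  LinearMap.mk₂ ℝ (fun x y => intLin refTriangle (∑ i, L i x * L i y))
    (fun x y z => by simp only [map_add, add_mul, Finset.sum_add_distrib])
    (fun c x y => by simp only [map_smul, smul_mul_assoc, ← Finset.smul_sum])
    (fun x y z => by simp only [map_add, mul_add, Finset.sum_add_distrib])
    (fun c x y => by simp only [map_smul, mul_smul_comm, ← Finset.smul_sum])

theorem l2Form_self {V ι : Type*} [AddCommGroup V] [Module ℝ V] [Fintype ι]
    (L : ι → V →ₗ[ℝ] Poly) (x : V) :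
    l2Form L x x = intLin refTriangle (∑ i, L i x ^ 2) := by
  simp [l2Form, pow_two]

/-- The squared length of a vector field. -/
def vecSq (q : Fin 2 → Poly) : Poly := ∑ i, q i ^ 2

/-- The squared length of a matrix field. -/
def matSq (σ : Matrix (Fin 2) (Fin 2) Poly) : Poly := ∑ z : Fin 2 × Fin 2, σ z.1 z.2 ^ 2

/-- The squared length of the gradient of a matrix field. -/
def gradSq (σ : Matrix (Fin 2) (Fin 2) Poly) : Poly :=
  ∑ z : Fin 2 × Fin 2 × Fin 2, partialD z.2.2 (σ z.1 z.2.1) ^ 2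

theorem val_vecSq (q : Fin 2 → Poly) (x : Plane) : val (vecSq q) x = ∑ i, val (q i) x ^ 2 := by
  simp only [vecSq, val_sum, val_pow]

theorem val_matSq (σ : Matrix (Fin 2) (Fin 2) Poly) (x : Plane) :
    val (matSq σ) x = ∑ z : Fin 2 × Fin 2, val (σ z.1 z.2) x ^ 2 := by
  simp only [matSq, val_sum, val_pow]

theorem val_gradSq (σ : Matrix (Fin 2) (Fin 2) Poly) (x : Plane) :
    val (gradSq σ) x =
      ∑ z : Fin 2 × Fin 2 × Fin 2, val (partialD z.2.2 (σ z.1 z.2.1)) x ^ 2 := by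
  simp only [gradSq, val_sum, val_pow]

theorem l2Norm_eq (T : Triangle) (q : Fin 2 → Poly) : l2Norm T q = √(intLin T (vecSq q)) := by
  simp only [l2Norm, intLin_apply, val_vecSq]

theorem h1Seminorm_eq (T : Triangle) (σ : Matrix (Fin 2) (Fin 2) Poly) :
    h1Seminorm T σ = √(intLin T (gradSq σ)) := by
  simp only [h1Seminorm, intLin_apply, val_gradSq, Fintype.sum_prod_type]

theorem h1Norm_eq (T : Triangle) (σ : Matrix (Fin 2) (Fin 2) Poly) :
    h1Norm T σ = √(intLin T (matSq σ) + intLin T (gradSq σ)) := by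
  have h : 0 ≤ intLin T (gradSq σ) := intLin_nonneg fun x => by rw [val_gradSq]; positivity
  rw [h1Norm, h1Seminorm_eq, Real.sq_sqrt h]
  simp only [intLin_apply, val_matSq, Fintype.sum_prod_type]

theorem sq_sum_mul_le {ι : Type*} [Fintype ι] (w z : ι → ℝ) {K : ℝ} (h : ∀ i, |w i| ≤ K) :
    (∑ i, w i * z i) ^ 2 ≤ Fintype.card ι * K ^ 2 * ∑ i, z i ^ 2 := by
  refine sq_sum_le_card_mul_sum_sq.trans ?_
  rw [mul_assoc, Finset.card_univ]
  refine mul_le_mul_of_nonneg_left ?_ (Nat.cast_nonneg _)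
  rw [Finset.mul_sum]
  refine Finset.sum_le_sum fun i _ => ?_
  rw [mul_pow]
  refine mul_le_mul_of_nonneg_right ?_ (sq_nonneg _)
  rw [← sq_abs]
  exact pow_le_pow_left₀ (abs_nonneg _) (h i) 2

section

variable {T : Triangle} {D ρ : ℝ}

theorem affMap_refMatrix_inv_affMap (T : Triangle) (x : Plane) :
    affMap (refMatrix T)⁻¹ (-linMap (refMatrix T)⁻¹ (T.points 0))
      (affMap (refMatrix T) (T.points 0) x) = x :=
  affMap_inverse' (refMatrix_inv_mul T) _ _

theorem val_matSq_pushMat_le (hM : ∀ i j, |refMatrix T i j| ≤ D)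
    (σ : Matrix (Fin 2) (Fin 2) Poly) (x : Plane) :
    val (pull (refMatrix T) (T.points 0) (matSq (pushMat T σ))) x ≤
      16 * D ^ 4 * val (matSq σ) x := by
  have hD : 0 ≤ D := (abs_nonneg _).trans (hM 0 0)
  have key : ∀ z ∈ (Finset.univ : Finset (Fin 2 × Fin 2)),
      val (pushMat T σ z.1 z.2) (affMap (refMatrix T) (T.points 0) x) ^ 2 ≤
        4 * D ^ 4 * val (matSq σ) x := by
    intro z _
    have := sq_sum_mul_le (fun y : Fin 2 × Fin 2 => refMatrix T z.1 y.1 * refMatrix T z.2 y.2)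
      (fun y => val (σ y.1 y.2) x) (K := D * D) fun y => by
        rw [abs_mul]
        exact mul_le_mul (hM _ _) (hM _ _) (abs_nonneg _) hD
    rw [← val_matSq] at this
    simp only [pushMat, pullMat_apply, val_sum, val_smul, val_pull, affMap_refMatrix_inv_affMap]
    simp only [Fintype.sum_prod_type] at this
    refine this.trans_eq ?_
    rw [show Fintype.card (Fin 2 × Fin 2) = 4 from rfl]
    push_cast
    ring
  rw [val_pull, val_matSq]
  refine (Finset.sum_le_sum key).trans_eq ?_
  simp
  ring

/-- Each entry is a sum of eight terms with two factors from `refMatrix T` and, by the chain rule,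
one from its inverse. Cauchy-Schwarz gives a factor 8, and there are eight entries. -/
theorem val_gradSq_pushMat_le (hM : ∀ i j, |refMatrix T i j| ≤ D)
    (hN : ∀ i j, |(refMatrix T)⁻¹ i j| ≤ ρ) (σ : Matrix (Fin 2) (Fin 2) Poly) (x : Plane) :
    val (pull (refMatrix T) (T.points 0) (gradSq (pushMat T σ))) x ≤
      64 * (D ^ 4 * ρ ^ 2) * val (gradSq σ) x := by
  have hD : 0 ≤ D := (abs_nonneg _).trans (hM 0 0)
  have key : ∀ z ∈ (Finset.univ : Finset (Fin 2 × Fin 2 × Fin 2)),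
      val (partialD z.2.2 (pushMat T σ z.1 z.2.1)) (affMap (refMatrix T) (T.points 0) x) ^ 2 ≤
        8 * (D ^ 4 * ρ ^ 2) * val (gradSq σ) x := by
    intro z _
    have := sq_sum_mul_le (fun y : Fin 2 × Fin 2 × Fin 2 =>
      refMatrix T z.1 y.1 * refMatrix T z.2.1 y.2.1 * (refMatrix T)⁻¹ y.2.2 z.2.2)
      (fun y => val (partialD y.2.2 (σ y.1 y.2.1)) x) (K := D * D * ρ) fun y => by
        rw [abs_mul, abs_mul]
        exact mul_le_mul (mul_le_mul (hM _ _) (hM _ _) (abs_nonneg _) hD) (hN _ _)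
          (abs_nonneg _) (by positivity)
    rw [← val_gradSq] at this
    simp only [pushMat, pullMat_apply, map_sum, map_smul, partialD_pull, val_sum, val_smul,
      val_pull, affMap_refMatrix_inv_affMap, Finset.mul_sum]
    simp only [Fintype.sum_prod_type, mul_assoc] at this ⊢
    refine this.trans_eq ?_
    rw [show Fintype.card (Fin 2 × Fin 2 × Fin 2) = 8 from rfl]
    push_cast
    ring
  rw [val_pull, val_gradSq]
  refine (Finset.sum_le_sum key).trans_eq ?_
  simp
  ring

theorem val_vecSq_pullVec_le (hN : ∀ i j, |(refMatrix T)⁻¹ i j| ≤ ρ)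
    (q : Fin 2 → Poly) (x : Plane) :
    val (vecSq (pullVec (refMatrix T)⁻¹ (refMatrix T) (T.points 0) q)) x ≤
      4 * ρ ^ 2 * val (pull (refMatrix T) (T.points 0) (vecSq q)) x := by
  have key : ∀ i ∈ (Finset.univ : Finset (Fin 2)),
      val (pullVec (refMatrix T)⁻¹ (refMatrix T) (T.points 0) q i) x ^ 2 ≤
        2 * ρ ^ 2 * val (pull (refMatrix T) (T.points 0) (vecSq q)) x := by
    intro i _
    have := sq_sum_mul_le (fun a => (refMatrix T)⁻¹ i a)
      (fun a => val (pull (refMatrix T) (T.points 0) (q a)) x) (hN i)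
    rw [pullVec_apply, val_sum]
    simp only [val_smul, val_pull, val_vecSq] at this ⊢
    simpa using this
  rw [val_vecSq]
  refine (Finset.sum_le_sum key).trans_eq ?_
  simp
  ring

end

theorem abs_refMatrix_le (T : Triangle) (i j : Fin 2) :
    |refMatrix T i j| ≤ Metric.diam (region T) := by
  have hmem : ∀ v, T.points v ∈ region T := fun v => subset_convexHull ℝ _ ⟨v, rfl⟩
  have h : ∀ v w, |T.points v i - T.points w i| ≤ Metric.diam (region T) := fun v w =>
    (PiLp.norm_apply_le (T.points v - T.points w) i).trans ((dist_eq_norm _ _).ge.trans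
      (Metric.dist_le_diam_of_mem (isCompact_region T).isBounded (hmem v) (hmem w)))
  fin_cases j
  · exact h 1 0
  · exact h 2 0

/-- The inverse affine map sends the disc into the reference triangle, where coordinates lie in `[0,
1]`. Moving from the centre by `r` along axis `j` changes coordinate `i` by `r * N i j`, which is
therefore at most one in absolute value. -/
theorem abs_refMatrix_inv_le {T : Triangle} {c : Plane} {r : ℝ} (hr : 0 < r)
    (h : Metric.closedBall c r ⊆ region T) (i j : Fin 2) : |(refMatrix T)⁻¹ i j| ≤ r⁻¹ := by
  set N := (refMatrix T)⁻¹
  set c' := -linMap N (T.points 0)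
  have hmem : ∀ x ∈ Metric.closedBall c r, affMap N c' x i ∈ Set.Icc (0 : ℝ) 1 := by
    intro x hx
    have h1 : affMap N c' x ∈ region refTriangle := by
      rw [region_eq_image (affMap_refMatrix_inv T)]
      exact Set.mem_image_of_mem _ (h hx)
    rw [region_refTriangle] at h1
    obtain ⟨h0, h1, h2⟩ := h1
    revert i
    rw [Fin.forall_fin_two]
    exact ⟨⟨h0, by linarith⟩, ⟨h1, by linarith⟩⟩
  have h1 := hmem c (Metric.mem_closedBall_self hr.le)
  have h2 := hmem (c + r • EuclideanSpace.single j 1) (by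
    simp [norm_smul, abs_of_pos hr])
  have h3 : affMap N c' (c + r • EuclideanSpace.single j 1) i = affMap N c' c i + r * N i j := by
    simp only [affMap_apply, Fin.sum_univ_two]
    fin_cases j <;> simp <;> ring
  rw [h3] at h2
  have h4 : |r * N i j| ≤ 1 :=
    abs_le.2 ⟨by linarith [h1.1, h1.2, h2.1, h2.2], by linarith [h1.1, h1.2, h2.1, h2.2]⟩
  rw [abs_mul, abs_of_pos hr, mul_comm] at h4
  rwa [← one_div, le_div_iff₀ hr]

/-- On the reference triangle the divergence has a linear right inverse on bubbles that is bounded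
from `L²` to `H¹`. -/
theorem exists_rightInverse_refTriangle (k : ℕ) :
    ∃ R : ↥(bubbleQ refTriangle (k - 1) ⊓ rmPerp refTriangle) →ₗ[ℝ] bubbleSigma refTriangle k,
      (∀ q, div (R q : Matrix (Fin 2) (Fin 2) Poly) = q) ∧
      (∃ C, 0 ≤ C ∧ ∀ q, intLin refTriangle (matSq (R q)) ≤ C * intLin refTriangle (vecSq q)) ∧
      ∃ C, 0 ≤ C ∧ ∀ q, intLin refTriangle (gradSq (R q)) ≤ C * intLin refTriangle (vecSq q) := by
  let W := bubbleQ refTriangle (k - 1) ⊓ rmPerp refTriangle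
  have hS : ∀ σ ∈ bubbleSigma refTriangle k, div σ ∈ W := fun σ hσ =>
    ⟨div_mem_bubbleQ hσ, div_mem_rmPerp hσ⟩
  obtain ⟨R, hR⟩ := LinearMap.exists_rightInverse_of_surjective (div.restrict hS)
    (LinearMap.range_eq_top.2 fun q => by
      obtain ⟨σ, hσ, h⟩ := exists_div_eq_refTriangle k q.2
      exact ⟨⟨σ, hσ⟩, Subtype.ext h⟩)
  have hfin : FiniteDimensional ℝ W :=
    Submodule.finiteDimensional_of_le (S₂ := bubbleQ refTriangle (k - 1)) inf_le_left
  let B : W →ₗ[ℝ] W →ₗ[ℝ] ℝ := l2Form fun i : Fin 2 => LinearMap.proj i ∘ₗ W.subtype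
  have hB : ∀ q, B q q = intLin refTriangle (vecSq q) := fun q => l2Form_self _ q
  have hsymm : ∀ x y, B x y = B y x := fun x y => by
    simp only [B, l2Form, LinearMap.mk₂_apply, mul_comm]
  have hnn : ∀ q x, 0 ≤ val (vecSq q) x := fun q x => by
    rw [val_vecSq]
    positivity
  have hnonneg : ∀ q, 0 ≤ B q q := fun q => by
    rw [hB]
    exact intLin_nonneg (hnn q)
  have hdef : ∀ q, B q q = 0 → q = 0 := fun q hq => by
    rw [hB] at hq
    have h := eq_zero_of_integral_refTriangle_eq_zero (fun x _ => hnn q x) hq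
    ext i : 2
    refine eq_zero_of_val fun x => ?_
    have h1 := congr_arg (fun p => val p x) h
    simp only [val_vecSq, val_zero] at h1
    exact pow_eq_zero_iff two_ne_zero |>.1
      ((Finset.sum_eq_zero_iff_of_nonneg fun _ _ => sq_nonneg _).1 h1 i (Finset.mem_univ i))
  refine ⟨R, fun q => congr_arg Subtype.val (LinearMap.congr_fun hR q), ?_, ?_⟩
  · obtain ⟨C, hC, h⟩ := exists_forall_le_mul (l2Form fun z : Fin 2 × Fin 2 =>
      Matrix.entryLinearMap ℝ Poly z.1 z.2 ∘ₗ (bubbleSigma refTriangle k).subtype ∘ₗ R) B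
      hsymm hnonneg hdef
    refine ⟨C, hC, fun q => ?_⟩
    have := h q
    rw [l2Form_self, hB] at this
    exact this
  · obtain ⟨C, hC, h⟩ := exists_forall_le_mul (l2Form fun z : Fin 2 × Fin 2 × Fin 2 =>
      partialD z.2.2 ∘ₗ Matrix.entryLinearMap ℝ Poly z.1 z.2.1 ∘ₗ
        (bubbleSigma refTriangle k).subtype ∘ₗ R) B hsymm hnonneg hdef
    refine ⟨C, hC, fun q => ?_⟩
    have := h q
    rw [l2Form_self, hB] at this
    exact this

theorem exists_bounded_rightInverse (k : ℕ) (κ : ℝ) : ∃ C : ℝ, ∀ T : Triangle, ShapeRegular κ T →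
    ∃ R : ↥(bubbleQ T (k - 1) ⊓ rmPerp T) →ₗ[ℝ] ↥(bubbleSigma T k), ∀ q,
      div (R q : Matrix (Fin 2) (Fin 2) Poly) = q ∧
      h1Seminorm T (R q) ≤ C * l2Norm T q ∧
      h1Norm T (R q) ≤ C * max 1 (Metric.diam (region T)) * l2Norm T q := by
  obtain ⟨R₀, hR₀, ⟨C₀, hC₀, h₀⟩, ⟨C₁, hC₁, h₁⟩⟩ := exists_rightInverse_refTriangle k
  -- Under the root stands the sum of the constants for the gradient (`64 · 4`) and for the field
  -- itself (`16 · 4`), so one constant serves both estimates.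
  refine ⟨√(256 * C₁ * (2 * κ) ^ 4 + 64 * C₀ * (2 * κ) ^ 2), fun T ⟨c, r, hr, hball, hdiam⟩ => ?_⟩
  let P : ↥(bubbleQ T (k - 1) ⊓ rmPerp T) →ₗ[ℝ]
      ↥(bubbleQ refTriangle (k - 1) ⊓ rmPerp refTriangle) :=
    (pullVec (refMatrix T)⁻¹ (refMatrix T) (T.points 0)).restrict fun q hq => pullVec_mem_inf hq
  let S : ↥(bubbleSigma refTriangle k) →ₗ[ℝ] ↥(bubbleSigma T k) :=
    (pushMat T).restrict fun σ hσ => pushMat_mem hσ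
  refine ⟨S ∘ₗ R₀ ∘ₗ P, fun q => ?_⟩
  have hP : (P q : Fin 2 → Poly) = pullVec (refMatrix T)⁻¹ (refMatrix T) (T.points 0) q := rfl
  have hSR : ((S ∘ₗ R₀ ∘ₗ P) q : Matrix (Fin 2) (Fin 2) Poly) = pushMat T (R₀ (P q)) := rfl
  rw [hSR]
  refine ⟨div_pushMat (hR₀ (P q)), ?_⟩
  set D := Metric.diam (region T) with hD
  have hD0 : 0 ≤ D := Metric.diam_nonneg
  have hM := abs_refMatrix_le T
  have hN := abs_refMatrix_inv_le hr hball
  have hκ : D * r⁻¹ ≤ 2 * κ := by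
    rw [← div_eq_mul_inv, div_le_iff₀ hr]
    linarith
  set ρ := r⁻¹ with hρ
  have hρ0 : 0 ≤ ρ := (inv_pos.2 hr).le
  have hκ0 : 0 ≤ D * ρ := mul_nonneg hD0 hρ0
  set J := |LinearMap.det (linMap (refMatrix T))|
  have hJ : 0 ≤ J := abs_nonneg _
  set I := intLin T (vecSq q) with hI
  have hI0 : 0 ≤ I := intLin_nonneg fun x => by rw [val_vecSq]; positivity
  -- The Jacobian `J` is kept on the left, so that it is absorbed here instead of being estimated.
  have hv : J * intLin refTriangle (vecSq (P q)) ≤ 4 * ρ ^ 2 * I := by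
    rw [hI, intLin_eq T, mul_left_comm]
    exact mul_le_mul_of_nonneg_left (intLin_le fun x => val_vecSq_pullVec_le hN q x) hJ
  have hg : intLin T (gradSq (pushMat T (R₀ (P q)))) ≤ 256 * C₁ * (2 * κ) ^ 4 * I := by
    calc _ ≤ J * (64 * (D ^ 4 * ρ ^ 2) * intLin refTriangle (gradSq (R₀ (P q)))) := by
          rw [intLin_eq]
          exact mul_le_mul_of_nonneg_left
            (intLin_le fun x => val_gradSq_pushMat_le hM hN _ x) hJ
      _ ≤ J * (64 * (D ^ 4 * ρ ^ 2) * (C₁ * intLin refTriangle (vecSq (P q)))) := by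
          gcongr
          exact h₁ _
      _ = 64 * (D ^ 4 * ρ ^ 2) * C₁ * (J * intLin refTriangle (vecSq (P q))) := by ring
      _ ≤ 64 * (D ^ 4 * ρ ^ 2) * C₁ * (4 * ρ ^ 2 * I) := by gcongr
      -- The powers of `D` and `ρ` balance, so the seminorm bound depends on the shape alone; in the
      -- estimate of the field itself a factor `D ^ 2` is left over, the source of the maximum with
      -- the diameter.
      _ = 256 * C₁ * (D * ρ) ^ 4 * I := by ring
      _ ≤ 256 * C₁ * (2 * κ) ^ 4 * I := by gcongr
  have hm : intLin T (matSq (pushMat T (R₀ (P q)))) ≤ 64 * C₀ * (2 * κ) ^ 2 * D ^ 2 * I := by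
    calc _ ≤ J * (16 * D ^ 4 * intLin refTriangle (matSq (R₀ (P q)))) := by
          rw [intLin_eq]
          exact mul_le_mul_of_nonneg_left (intLin_le fun x => val_matSq_pushMat_le hM _ x) hJ
      _ ≤ J * (16 * D ^ 4 * (C₀ * intLin refTriangle (vecSq (P q)))) := by
          gcongr
          exact h₀ _
      _ = 16 * D ^ 4 * C₀ * (J * intLin refTriangle (vecSq (P q))) := by ring
      _ ≤ 16 * D ^ 4 * C₀ * (4 * ρ ^ 2 * I) := by gcongr
      _ = 64 * C₀ * (D * ρ) ^ 2 * D ^ 2 * I := by ring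
      _ ≤ 64 * C₀ * (2 * κ) ^ 2 * D ^ 2 * I := by gcongr
  rw [h1Seminorm_eq, h1Norm_eq, l2Norm_eq]
  set a := 256 * C₁ * (2 * κ) ^ 4 with ha
  set b := 64 * C₀ * (2 * κ) ^ 2 with hb
  have ha0 : 0 ≤ a := by positivity
  have hb0 : 0 ≤ b := by positivity
  constructor
  · rw [← Real.sqrt_mul (by positivity)]
    refine Real.sqrt_le_sqrt (hg.trans ?_)
    gcongr
    linarith
  · have hmax : 0 ≤ max 1 D := zero_le_one.trans (le_max_left _ _)
    have h1 : 1 ≤ max 1 D ^ 2 := one_le_pow₀ (le_max_left _ _)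
    have h2 : D ^ 2 ≤ max 1 D ^ 2 := pow_le_pow_left₀ hD0 (le_max_right _ _) 2
    have h3 : √(a + b) * max 1 D = √((a + b) * max 1 D ^ 2) := by
      rw [Real.sqrt_mul (by positivity), Real.sqrt_sq hmax]
    rw [h3, ← Real.sqrt_mul (by positivity)]
    refine Real.sqrt_le_sqrt ((add_le_add hm hg).trans ?_)
    calc b * D ^ 2 * I + a * I = (b * D ^ 2 + a * 1) * I := by ring
      _ ≤ (b * max 1 D ^ 2 + a * max 1 D ^ 2) * I := by gcongr
      _ = (a + b) * max 1 D ^ 2 * I := by ring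

end BubbleComplex

end

theorem mainTheorem9 :
    -- the bubble sequence is a complex and is exact on every triangle
    (∀ (k : ℕ), 1 ≤ k → ∀ (T : BubbleComplex.Triangle),
      ∃ (hU : ∀ u ∈ BubbleComplex.bubbleU T (k + 2),
            BubbleComplex.airy u ∈ BubbleComplex.bubbleSigma T k)
        (hS : ∀ σ ∈ BubbleComplex.bubbleSigma T k,
            BubbleComplex.div σ ∈ BubbleComplex.bubbleQ T (k - 1) ⊓ BubbleComplex.rmPerp T),
        Function.Injective (BubbleComplex.airy.restrict hU) ∧
        Function.Exact (BubbleComplex.airy.restrict hU) (BubbleComplex.div.restrict hS) ∧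
        Function.Surjective (BubbleComplex.div.restrict hS)) ∧
    -- bounded right inverse of the divergence on bubbles
    (∀ (k : ℕ), 7 ≤ k → ∀ (κ : ℝ), ∃ C : ℝ, ∀ (T : BubbleComplex.Triangle),
      BubbleComplex.ShapeRegular κ T →
      ∃ R : ↥(BubbleComplex.bubbleQ T (k - 1) ⊓ BubbleComplex.rmPerp T) →ₗ[ℝ]
          ↥(BubbleComplex.bubbleSigma T k),
        ∀ q : ↥(BubbleComplex.bubbleQ T (k - 1) ⊓ BubbleComplex.rmPerp T),
          BubbleComplex.div (R q : Matrix (Fin 2) (Fin 2) BubbleComplex.Poly) = q ∧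
          BubbleComplex.h1Seminorm T (R q) ≤ C * BubbleComplex.l2Norm T q ∧
          BubbleComplex.h1Norm T (R q) ≤
            C * max 1 (Metric.diam (BubbleComplex.region T)) * BubbleComplex.l2Norm T q) := by
  refine ⟨fun k _ T => ⟨fun u hu => BubbleComplex.airy_mem_bubbleSigma hu,
    fun σ hσ => ⟨BubbleComplex.div_mem_bubbleQ hσ, BubbleComplex.div_mem_rmPerp hσ⟩, ?_, ?_, ?_⟩,
    fun k _ κ => BubbleComplex.exists_bounded_rightInverse k κ⟩
  · rw [injective_iff_map_eq_zero]
    exact fun u hu => Subtype.ext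
      (BubbleComplex.eq_zero_of_airy_eq_zero u.2 (congr_arg Subtype.val hu))
  · intro σ
    constructor
    · intro h
      obtain ⟨u, hu, h'⟩ := BubbleComplex.exists_airy_eq σ.2 (congr_arg Subtype.val h)
      exact ⟨⟨u, hu⟩, Subtype.ext h'⟩
    · rintro ⟨u, rfl⟩
      exact Subtype.ext (BubbleComplex.div_airy u)
  · intro q
    obtain ⟨σ, hσ, h⟩ := BubbleComplex.exists_div_eq q.2
    exact ⟨⟨σ, hσ⟩, Subtype.ext h⟩
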